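/- Let $0<q<1$ and $a\in\mathbb R$; put $t=q^{a}-q^{-a}$, $[x]=\frac{q^{x}-q^{-x}}{q-q^{-1}}$, $\{x\}=q^{x}+q^{-x}$. Let $\mathcal O_q(SU(2))$ be the unital $*$-algebra generated by $\alpha,\gamma$ with $\alpha^*\alpha+\gamma^*\gamma=1$, $\alpha\alpha^*+q^2\gamma\gamma^*=1$, $\gamma^*\gamma=\gamma\gamma^*$, $\alpha\gamma=q\gamma\alpha$, $\alpha\gamma^*=q\gamma^*\alpha$, with counit $\epsilon(\alpha)=1$, $\epsilon(\gamma)=0$. The Hopf $*$-algebra $U_q(\mathfrak{su}(2))$, generated by $k^{\pm1},e,f$ with $\Delta(k)=k\otimes k$, $\Delta(e)=e\otimes 1+k\otimes e$, $\Delta(f)=1\otimes f+f\otimes k^{-1}$, acts on it from the left by $h\rhd x=x_{(1)}(x_{(2)},h)$: one has $h\rhd(xy)=(h_{(1)}\rhd x)(h_{(2)}\rhd y)$; $k$ multiplies $\alpha,\gamma$ by $q$ and $\alpha^*,\gamma^*$ by $q^{-1}$; $e\rhd\alpha=e\rhd\gamma=0$, $e\rhd\gamma^*=-q^{-1/2}\alpha$,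 $e\rhd\alpha^*=q^{1/2}\gamma$; $f\rhd\alpha=-q^{1/2}\gamma^*$, $f\rhd\gamma=q^{-1/2}\alpha^*$, $f\rhd\alpha^*=f\rhd\gamma^*=0$. Let $B_t=q^{-1/2}(e-fk)-\sqrt{-1}\,(q-q^{-1})^{-1}t\,k$ and let $R$ be the unitary antipode, so that $R(B_t)=q^{1/2}(f-k^{-1}e)-\sqrt{-1}\,[a]\,k^{-1}$ and $\epsilon(B_t)=-\sqrt{-1}\,[a]$. The Podleś sphere is the unital $*$-subalgebra $$\mathcal O_q(S_t^2)=\{x\in\mathcal O_q(SU(2)) : R(B_t)\rhd x=\epsilon(B_t)x\}.$$ Let $\mathcal I_c$ be the space of finitely supported functions $h\colon\mathbb Z\to\mathbb C$, where $m\in\mathbb Z$ stands for the weight $[a+m]$ of $\sqrt{-1}R(B_t)$. The algebra $\mathcal O_q(SU(2))$ acts on $\mathcal I_c$ by $x\rhd h=h_{(1)}(x,h_{(2)})$; explicitly, with $y=a+m$, $$(\alpha\rhd h)(m)=\tfrac{q^{-y}h(m+1)+q^{y}h(m-1)}{\{y\}},\qquad (\alpha^*\rhd h)(m)=\tfrac{q^{y}h(m+1)+q^{-y}h(m-1)}{\{y\}},$$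 $$(\gamma\rhd h)(m)=\sqrt{-1}\,\tfrac{h(m+1)-h(m-1)}{\{y\}},\qquad (\gamma^*\rhd h)(m)=q^{-1}\sqrt{-1}\,\tfrac{h(m+1)-h(m-1)}{\{y\}}.$$ Write $e_{a+2n}$ for the indicator function of $2n$. Elements of $\mathcal O_q(S_t^2)$ preserve the span of the $e_{a+2n}$, $n\in\mathbb Z$ (the module $\mathcal M_{q+q^{-1},a}$), and the span of the $e_{a+2n}$, $n\neq0$; the latter is $\mathcal D_2^+\oplus\mathcal D_2^-$, where $\mathcal D_2^{+}$ and $\mathcal D_2^{-}$ are spanned by the $e_{a+2n}$ with $n>0$ and with $n<0$. Let $\pi$ be the resulting representation of $\mathcal O_q(S_t^2)$ on $\mathcal D_2^+\oplus\mathcal D_2^-$. Equip this space with the inner product for which the $e_{a+2n}$ are orthogonal with $$\|e_{a+2n}\|^2=\frac{\{a+2\}}{\{a\}\,(\{2a+1\}+q+q^{-1})}\cdot\frac{\{a+2n\}}{(q^{-1}-q)\,|q^{-n}-q^{n}|\,\{a+n\}},\qquad n\ne0,$$ and let $$C\colon\mathcal O_q(S_t^2)\to\mathcal D_2^+\oplus\mathcal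 D_2^-,\qquad C(b)=b\rhd e_a-\epsilon(b)e_a .$$ **Proposition.** The subspaces $\mathcal D_2^+$ and $\mathcal D_2^-$ are invariant under $\pi$, $\pi$ is a $*$-representation, $C$ is a surjective $(\pi,\epsilon)$-$1$-cocycle, that is $C(bc)=\pi(b)C(c)+C(b)\epsilon(c)$, and $C$ is purely non-Gaussian: if $P_G$ is the orthogonal projection of the Hilbert space completion of $\mathcal D_2^+\oplus\mathcal D_2^-$ onto $$H_G=\{(\pi(b)-\epsilon(b))C(c) : b,c\in\mathcal O_q(S_t^2)\}^{\perp},$$ then $P_G(\mathcal D_2^+\oplus\mathcal D_2^-)=0$. -/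

import Mathlib

open scoped ComplexConjugate InnerProductSpace

noncomputable section

namespace QPodles

/-- The range of the deformation parameter: `0 < q < 1`. -/
abbrev Param : Type := Set.Ioo (0 : ℝ) 1

/-- `[x] = (q^x - q^(-x)) / (q - q⁻¹)`. -/
def brk (q : Param) (x : ℝ) : ℝ :=
  ((q : ℝ) ^ x - (q : ℝ) ^ (-x)) / ((q : ℝ) - (q : ℝ)⁻¹)

/-- `{x} = q^x + q^(-x)`. -/
def cur (q : Param) (x : ℝ) : ℝ := (q : ℝ) ^ x + (q : ℝ) ^ (-x)

/-- `q` as a complex number. -/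
def qc (q : Param) : ℂ := ((q : ℝ) : ℂ)

/-- `q^(1/2)` as a complex number. -/
def qh (q : Param) : ℂ := ((Real.sqrt (q : ℝ) : ℝ) : ℂ)

/-! ### The Hopf *-algebra `O_q(SU(2))` as a *-algebra -/

/-- Generators `α, α*, γ, γ*`. -/
inductive Gen : Type
  | α | αs | γ | γs

/-- The involution on generators. -/
def Gen.inv : Gen → Gen
  | .α => .αs
  | .αs => .α
  | .γ => .γs
  | .γs => .γ

/-- The relations of `O_q(SU(2))` for four elements of a complex algebra; the last two are the
adjoints of the two relations before them. -/
structure GenRel {B : Type*} [Ring B] [Algebra ℂ B] (c : ℂ) (v : Gen → B) : Prop where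
  r1 : v .αs * v .α + v .γs * v .γ = 1
  r2 : v .α * v .αs + c ^ 2 • (v .γ * v .γs) = 1
  r3 : v .γs * v .γ = v .γ * v .γs
  r4 : v .α * v .γ = c • (v .γ * v .α)
  r5 : v .α * v .γs = c • (v .γs * v .α)
  r6 : v .γs * v .αs = c • (v .αs * v .γs)
  r7 : v .γ * v .αs = c • (v .αs * v .γ)

/-- The same relations, in the free algebra. -/
inductive Rel (q : Param) : FreeAlgebra ℂ Gen → FreeAlgebra ℂ Gen → Prop
  | r1 : Rel q (.ι ℂ .αs * .ι ℂ .α + .ι ℂ .γs * .ι ℂ .γ) 1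
  | r2 : Rel q (.ι ℂ .α * .ι ℂ .αs + qc q ^ 2 • (.ι ℂ .γ * .ι ℂ .γs)) 1
  | r3 : Rel q (.ι ℂ .γs * .ι ℂ .γ) (.ι ℂ .γ * .ι ℂ .γs)
  | r4 : Rel q (.ι ℂ .α * .ι ℂ .γ) (qc q • (.ι ℂ .γ * .ι ℂ .α))
  | r5 : Rel q (.ι ℂ .α * .ι ℂ .γs) (qc q • (.ι ℂ .γs * .ι ℂ .α))
  | r6 : Rel q (.ι ℂ .γs * .ι ℂ .αs) (qc q • (.ι ℂ .αs * .ι ℂ .γs))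
  | r7 : Rel q (.ι ℂ .γ * .ι ℂ .αs) (qc q • (.ι ℂ .αs * .ι ℂ .γ))

/-- The algebra `O_q(SU(2))`. -/
def Oq (q : Param) : Type := RingQuot (Rel q)

instance (q : Param) : Ring (Oq q) := inferInstanceAs (Ring (RingQuot (Rel q)))
instance (q : Param) : Algebra ℂ (Oq q) := inferInstanceAs (Algebra ℂ (RingQuot (Rel q)))

namespace Oq

variable {q : Param}

/-- The quotient map. -/
def mk (q : Param) : FreeAlgebra ℂ Gen →ₐ[ℂ] Oq q := RingQuot.mkAlgHom ℂ (Rel q)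

theorem mk_rel {x y : FreeAlgebra ℂ Gen} (h : Rel q x y) : mk q x = mk q y :=
  RingQuot.mkAlgHom_rel ℂ h

/-- The generators of `O_q(SU(2))`. -/
def gen (q : Param) (g : Gen) : Oq q := mk q (FreeAlgebra.ι ℂ g)

/-- Universal property of `O_q(SU(2))`. -/
def lift {B : Type*} [Ring B] [Algebra ℂ B] (v : Gen → B) (h : GenRel (qc q) v) : Oq q →ₐ[ℂ] B :=
  RingQuot.liftAlgHom ℂ ⟨FreeAlgebra.lift ℂ v, by
    intro x y hxy
    cases hxy with
    | r1 => simpa using h.r1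
    | r2 => simpa using h.r2
    | r3 => simpa using h.r3
    | r4 => simpa using h.r4
    | r5 => simpa using h.r5
    | r6 => simpa using h.r6
    | r7 => simpa using h.r7⟩

@[simp] theorem lift_gen {B : Type*} [Ring B] [Algebra ℂ B] (v : Gen → B)
    (h : GenRel (qc q) v) (g : Gen) : lift v h (gen q g) = v g := by
  unfold lift gen mk
  erw [RingQuot.liftAlgHom_mkAlgHom_apply]
  simp

theorem genRel (q : Param) : GenRel (qc q) (gen q) where
  r1 := by simpa only [gen, map_add, map_mul, map_smul, map_one] using mk_rel (Rel.r1 (q := q))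
  r2 := by simpa only [gen, map_add, map_mul, map_smul, map_one] using mk_rel (Rel.r2 (q := q))
  r3 := by simpa only [gen, map_add, map_mul, map_smul, map_one] using mk_rel (Rel.r3 (q := q))
  r4 := by simpa only [gen, map_add, map_mul, map_smul, map_one] using mk_rel (Rel.r4 (q := q))
  r5 := by simpa only [gen, map_add, map_mul, map_smul, map_one] using mk_rel (Rel.r5 (q := q))
  r6 := by simpa only [gen, map_add, map_mul, map_smul, map_one] using mk_rel (Rel.r6 (q := q))
  r7 := by simpa only [gen, map_add, map_mul, map_smul, map_one] using mk_rel (Rel.r7 (q := q))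

theorem induction {P : Oq q → Prop} (hc : ∀ c : ℂ, P (algebraMap ℂ _ c)) (hg : ∀ g, P (gen q g))
    (ha : ∀ x y, P x → P y → P (x + y)) (hm : ∀ x y, P x → P y → P (x * y)) (x : Oq q) : P x := by
  obtain ⟨y, rfl⟩ := RingQuot.mkAlgHom_surjective ℂ (Rel q) x
  change P (mk q y)
  induction y using FreeAlgebra.induction with
  | grade0 r => rw [AlgHom.commutes]; exact hc r
  | grade1 g => exact hg g
  | mul a b h1 h2 => rw [map_mul]; exact hm _ _ h1 h2
  | add a b h1 h2 => rw [map_add]; exact ha _ _ h1 h2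

/-! The involution: the antilinear antiautomorphism exchanging `α, α*` and `γ, γ*`. -/

/-- The opposite algebra of `O_q(SU(2))` with the conjugate scalar structure. -/
def OpConj (q : Param) : Type := (Oq q)ᵐᵒᵖ

instance : Ring (OpConj q) := inferInstanceAs (Ring (Oq q)ᵐᵒᵖ)
instance : Algebra ℂ (OpConj q) :=
  RingHom.toAlgebra' ((algebraMap ℂ (Oq q)ᵐᵒᵖ).comp (starRingEnd ℂ)) (fun c x => by
    exact Algebra.commutes (R := ℂ) (A := (Oq q)ᵐᵒᵖ) (conj c) x)

theorem OpConj.smul_op (c : ℂ) (x : Oq q) :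
    (c • (show OpConj q from MulOpposite.op x)) =
      (show OpConj q from MulOpposite.op (conj c • x)) := by
  rw [Algebra.smul_def]
  change (algebraMap ℂ (Oq q)ᵐᵒᵖ (conj c)) * MulOpposite.op x = _
  rw [← Algebra.smul_def]; rfl

theorem conj_qc (q : Param) : conj (qc q) = qc q := by simp [qc]

/-- The involution as a homomorphism into the conjugate opposite algebra. -/
def starHom (q : Param) : Oq q →ₐ[ℂ] OpConj q :=
  lift (fun g => (show OpConj q from MulOpposite.op (gen q g.inv))) (by
    have h := genRel q
    have key : ∀ (c : ℂ) (x y z w : Oq q), conj c = c → y * x = c • (z * w) →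
        (show OpConj q from MulOpposite.op x) * (show OpConj q from MulOpposite.op y) =
          c • ((show OpConj q from MulOpposite.op w) * (show OpConj q from MulOpposite.op z)) := by
      intro c x y z w hc hxy
      refine Eq.trans (congrArg MulOpposite.op hxy) ?_
      refine Eq.trans ?_ (OpConj.smul_op c (z * w)).symm
      rw [hc]
    refine ⟨?_, ?_, ?_, ?_, ?_, ?_, ?_⟩
    · exact congrArg MulOpposite.op h.r1
    · refine Eq.trans ?_ (congrArg MulOpposite.op h.r2)
      refine congrArg₂ (fun x y : OpConj q => x + y) rfl ?_
      refine (OpConj.smul_op (qc q ^ 2) (gen q .γ * gen q .γs)).trans ?_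
      rw [map_pow, conj_qc]
      rfl
    · exact congrArg MulOpposite.op h.r3
    · exact key _ _ _ _ _ (conj_qc q) h.r6
    · exact key _ _ _ _ _ (conj_qc q) h.r7
    · exact key _ _ _ _ _ (conj_qc q) h.r4
    · exact key _ _ _ _ _ (conj_qc q) h.r5)

instance : Star (Oq q) := ⟨fun x => MulOpposite.unop (show (Oq q)ᵐᵒᵖ from starHom q x)⟩

theorem star_gen (g : Gen) : star (gen q g) = gen q g.inv := by
  change MulOpposite.unop (show (Oq q)ᵐᵒᵖ from starHom q (gen q g)) = _
  rw [starHom, lift_gen]; rfl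

theorem star_mul' (x y : Oq q) : star (x * y) = star y * star x := by
  change MulOpposite.unop (show (Oq q)ᵐᵒᵖ from starHom q (x * y)) = _
  rw [map_mul]; rfl

theorem star_add' (x y : Oq q) : star (x + y) = star x + star y := by
  change MulOpposite.unop (show (Oq q)ᵐᵒᵖ from starHom q (x + y)) = _
  rw [map_add]; rfl

theorem star_algebraMap' (c : ℂ) :
    star (algebraMap ℂ (Oq q) c) = algebraMap ℂ (Oq q) (conj c) := by
  change MulOpposite.unop (show (Oq q)ᵐᵒᵖ from starHom q (algebraMap ℂ (Oq q) c)) = _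
  rw [AlgHom.commutes]; rfl

instance : StarRing (Oq q) where
  star_involutive x := by
    induction x using induction with
    | hc c => rw [star_algebraMap', star_algebraMap', Complex.conj_conj]
    | hg g => rw [star_gen, star_gen]; cases g <;> rfl
    | ha x y hx hy => rw [star_add', star_add', hx, hy]
    | hm x y hx hy => rw [star_mul', star_mul', hx, hy]
  star_mul := star_mul'
  star_add := star_add'

instance : StarModule ℂ (Oq q) where
  star_smul c x := by
    rw [Algebra.smul_def, star_mul, star_algebraMap', Algebra.smul_def, Algebra.commutes]; rfl

/-- The counit. -/
def counit (q : Param) : Oq q →ₐ[ℂ] ℂ :=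
  lift (fun g => match g with
    | .α => 1
    | .αs => 1
    | .γ => 0
    | .γs => 0) (by constructor <;> simp)

theorem qc_ne (q : Param) : qc q ≠ 0 := by
  have := q.2.1
  simp [qc]; exact this.ne'

theorem qh_ne (q : Param) : qh q ≠ 0 := by
  have := q.2.1
  simp only [qh, ne_eq, Complex.ofReal_eq_zero]; exact (Real.sqrt_pos.2 this).ne'

theorem qh_mul (q : Param) : qh q * qh q = qc q := by
  rw [qh, ← Complex.ofReal_mul, Real.mul_self_sqrt q.2.1.le]; rfl

/-- The left action `k ▷` of `k ∈ U_q(su(2))`: it multiplies the first column `α, γ` of the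
fundamental corepresentation by `q` and the second column `-q γ*, α*` by `q⁻¹`. -/
def kAct (q : Param) : Oq q →ₐ[ℂ] Oq q :=
  lift (fun g => match g with
    | .α => qc q • gen q .α
    | .αs => (qc q)⁻¹ • gen q .αs
    | .γ => qc q • gen q .γ
    | .γs => (qc q)⁻¹ • gen q .γs) (by
      have h := genRel q
      have hq := qc_ne q
      constructor <;> simp only [smul_mul_assoc, mul_smul_comm, smul_smul, mul_inv_cancel₀ hq,
        inv_mul_cancel₀ hq, one_smul]
      · exact h.r1
      · exact h.r2
      · exact h.r3
      all_goals first | rw [h.r4] | rw [h.r5] | rw [h.r6] | rw [h.r7]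
      all_goals simp only [smul_smul]
      all_goals congr 1
      all_goals field_simp)

/-- The left action `k⁻¹ ▷`. -/
def kInvAct (q : Param) : Oq q →ₐ[ℂ] Oq q :=
  lift (fun g => match g with
    | .α => (qc q)⁻¹ • gen q .α
    | .αs => qc q • gen q .αs
    | .γ => (qc q)⁻¹ • gen q .γ
    | .γs => qc q • gen q .γs) (by
      have h := genRel q
      have hq := qc_ne q
      constructor <;> simp only [smul_mul_assoc, mul_smul_comm, smul_smul, mul_inv_cancel₀ hq,
        inv_mul_cancel₀ hq, one_smul]
      · exact h.r1
      · exact h.r2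
      · exact h.r3
      all_goals first | rw [h.r4] | rw [h.r5] | rw [h.r6] | rw [h.r7]
      all_goals simp only [smul_smul]
      all_goals congr 1
      all_goals field_simp)

/-- The homomorphism `x ↦ (k ▷ x, e ▷ x; 0, x)`. That it is multiplicative encodes
`e ▷ (x y) = (e ▷ x) y + (k ▷ x) (e ▷ y)`, that is `Δ(e) = e ⊗ 1 + k ⊗ e`; on generators, `e ▷`
maps the second column `-q γ*, α*` to `q^(1/2)` times the first column `α, γ`, and kills the
first column. -/
def eMat (q : Param) : Oq q →ₐ[ℂ] Matrix (Fin 2) (Fin 2) (Oq q) :=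
  lift (fun g => match g with
    | .α => !![qc q • gen q .α, 0; 0, gen q .α]
    | .αs => !![(qc q)⁻¹ • gen q .αs, qh q • gen q .γ; 0, gen q .αs]
    | .γ => !![qc q • gen q .γ, 0; 0, gen q .γ]
    | .γs => !![(qc q)⁻¹ • gen q .γs, -(qh q)⁻¹ • gen q .α; 0, gen q .γs]) (by
      have h := genRel q
      have hq := qc_ne q
      have hh := qh_ne q
      have hm := qh_mul q
      have e1 := eq_sub_of_add_eq h.r1
      have e2 := eq_sub_of_add_eq h.r2
      constructor <;> ext i j <;> fin_cases i <;> fin_cases j <;>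
        simp [smul_smul, hq, e1, e2, h.r3, h.r4, h.r5, h.r6, h.r7]
      all_goals rw [← hm]
      all_goals match_scalars
      all_goals field_simp
      all_goals ring)

/-- The homomorphism `x ↦ (x, f ▷ x; 0, k⁻¹ ▷ x)`. That it is multiplicative encodes
`f ▷ (x y) = x (f ▷ y) + (f ▷ x) (k⁻¹ ▷ y)`, that is `Δ(f) = 1 ⊗ f + f ⊗ k⁻¹`; on generators, `f ▷`
maps the first column `α, γ` to `q^(-1/2)` times the second column `-q γ*, α*`, and kills the
second column. -/
def fMat (q : Param) : Oq q →ₐ[ℂ] Matrix (Fin 2) (Fin 2) (Oq q) :=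
  lift (fun g => match g with
    | .α => !![gen q .α, -qh q • gen q .γs; 0, (qc q)⁻¹ • gen q .α]
    | .αs => !![gen q .αs, 0; 0, qc q • gen q .αs]
    | .γ => !![gen q .γ, (qh q)⁻¹ • gen q .αs; 0, (qc q)⁻¹ • gen q .γ]
    | .γs => !![gen q .γs, 0; 0, qc q • gen q .γs]) (by
      have h := genRel q
      have hq := qc_ne q
      have hh := qh_ne q
      have hm := qh_mul q
      have e1 := eq_sub_of_add_eq h.r1
      have e2 := eq_sub_of_add_eq h.r2
      constructor <;> ext i j <;> fin_cases i <;> fin_cases j <;>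
        simp [smul_smul, hq, e1, e2, h.r3, h.r4, h.r5, h.r6, h.r7]
      all_goals rw [← hm]
      all_goals match_scalars
      all_goals field_simp
      all_goals ring)

/-- The left action `e ▷`. -/
def eAct (q : Param) : Oq q →ₗ[ℂ] Oq q :=
  Matrix.entryLinearMap ℂ (Oq q) 0 1 ∘ₗ (eMat q).toLinearMap

/-- The left action `f ▷`. -/
def fAct (q : Param) : Oq q →ₗ[ℂ] Oq q :=
  Matrix.entryLinearMap ℂ (Oq q) 0 1 ∘ₗ (fMat q).toLinearMap

/-- The left action `R(B_t) ▷`, where `t = q^a - q^(-a)`,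
`B_t = q^(-1/2) (e - f k) - i (q - q⁻¹)⁻¹ t k` and `R` is the unitary antipode, the
*-preserving antiautomorphism with `R(k) = k⁻¹`, `R(e) = -q k⁻¹ e`, `R(f k) = -q f`; thus
`R(B_t) = q^(1/2) (f - k⁻¹ e) - i [a] k⁻¹`. -/
def RBAct (q : Param) (a : ℝ) : Oq q →ₗ[ℂ] Oq q :=
  qh q • (fAct q - (kInvAct q).toLinearMap ∘ₗ eAct q)
    - (Complex.I * (brk q a : ℂ)) • (kInvAct q).toLinearMap

/-- `ε(B_t) = -i [a]`. -/
def epsB (q : Param) (a : ℝ) : ℂ := -(Complex.I * (brk q a : ℂ))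

theorem eMat_eq (x : Oq q) : eMat q x = !![kAct q x, eAct q x; 0, x] := by
  have h : eMat q x 0 0 = kAct q x ∧ eMat q x 1 0 = 0 ∧ eMat q x 1 1 = x := by
    induction x using induction with
    | hc c => simp [Matrix.algebraMap_matrix_apply]
    | hg g => cases g <;> simp [eMat, kAct]
    | ha x y hx hy => simp [hx, hy]
    | hm x y hx hy => simp [Matrix.mul_apply, Fin.sum_univ_two, hx, hy]
  ext i j
  fin_cases i <;> fin_cases j
  · exact h.1
  · rfl
  · exact h.2.1
  · exact h.2.2

theorem fMat_eq (x : Oq q) : fMat q x = !![x, fAct q x; 0, kInvAct q x] := by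
  have h : fMat q x 0 0 = x ∧ fMat q x 1 0 = 0 ∧ fMat q x 1 1 = kInvAct q x := by
    induction x using induction with
    | hc c => simp [Matrix.algebraMap_matrix_apply]
    | hg g => cases g <;> simp [fMat, kInvAct]
    | ha x y hx hy => simp [hx, hy]
    | hm x y hx hy => simp [Matrix.mul_apply, Fin.sum_univ_two, hx, hy]
  ext i j
  fin_cases i <;> fin_cases j
  · exact h.1
  · rfl
  · exact h.2.1
  · exact h.2.2

theorem eAct_mul (x y : Oq q) : eAct q (x * y) = kAct q x * eAct q y + eAct q x * y := by
  have h : eMat q (x * y) = eMat q x * eMat q y := map_mul _ _ _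
  rw [eMat_eq, eMat_eq, eMat_eq] at h
  simpa using congrFun₂ h 0 1

theorem fAct_mul (x y : Oq q) : fAct q (x * y) = x * fAct q y + fAct q x * kInvAct q y := by
  have h : fMat q (x * y) = fMat q x * fMat q y := map_mul _ _ _
  rw [fMat_eq, fMat_eq, fMat_eq] at h
  simpa using congrFun₂ h 0 1

theorem kInvAct_kAct (x : Oq q) : kInvAct q (kAct q x) = x := by
  induction x using induction with
  | hc c => simp
  | hg g => cases g <;> simp [kInvAct, kAct, smul_smul, qc_ne]
  | ha x y hx hy => simp [hx, hy]
  | hm x y hx hy => simp [hx, hy]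

/-- `(R(B_t) - ε(B_t)) ▷`. -/
def skew (q : Param) (a : ℝ) : Oq q →ₗ[ℂ] Oq q := RBAct q a - epsB q a • LinearMap.id

theorem skew_apply (a : ℝ) (x : Oq q) : skew q a x =
    qh q • (fAct q x - kInvAct q (eAct q x)) - (Complex.I * (brk q a : ℂ)) • (kInvAct q x - x) := by
  simp [skew, RBAct, epsB, smul_sub]; abel

theorem skew_mul (a : ℝ) (x y : Oq q) :
    skew q a (x * y) = x * skew q a y + skew q a x * kInvAct q y := by
  simp only [skew_apply, eAct_mul, fAct_mul, map_mul, map_add, kInvAct_kAct, smul_sub, smul_add,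
    mul_sub, sub_mul, mul_smul_comm, smul_mul_assoc]
  abel

theorem skew_algebraMap (a : ℝ) (c : ℂ) : skew q a (algebraMap ℂ _ c) = 0 := by
  simp [skew_apply, eAct, fAct, Matrix.algebraMap_matrix_apply]

theorem skew_gen (a : ℝ) (g : Gen) : skew q a (gen q g) = match g with
    | .α => -qc q • gen q .γs - (Complex.I * (brk q a : ℂ) * ((qc q)⁻¹ - 1)) • gen q .α
    | .γ => gen q .αs - (Complex.I * (brk q a : ℂ) * ((qc q)⁻¹ - 1)) • gen q .γ
    | .γs => (qc q)⁻¹ • gen q .α - (Complex.I * (brk q a : ℂ) * (qc q - 1)) • gen q .γs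
    | .αs => - gen q .γ - (Complex.I * (brk q a : ℂ) * (qc q - 1)) • gen q .αs := by
  have hm := qh_mul q
  have hh := qh_ne q
  rw [skew_apply]
  cases g <;> simp [eAct, fAct, eMat, fMat, kInvAct, smul_smul] <;> rw [← hm] <;> match_scalars <;>
    field_simp

theorem kInvAct_star (x : Oq q) : kInvAct q (star (kInvAct q x)) = star x := by
  induction x using induction with
  | hc c => simp [star_algebraMap']
  | hg g =>
    cases g <;> simp [kInvAct, star_gen, Gen.inv, smul_smul, qc_ne, conj_qc]
  | ha x y hx hy => simp [hx, hy]
  | hm x y hx hy => simp [hx, hy]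

theorem skew_star (a : ℝ) (x : Oq q) :
    skew q a (star x) = kInvAct q (star (skew q a x)) := by
  induction x using induction with
  | hc c => simp [star_algebraMap', skew_algebraMap]
  | hg g =>
    have hq := qc_ne q
    rw [star_gen]
    cases g <;> simp only [Gen.inv, skew_gen] <;>
      simp [star_gen, Gen.inv, smul_smul, kInvAct, conj_qc] <;>
      match_scalars <;> field_simp <;> ring
  | ha x y hx hy => simp [hx, hy]
  | hm x y hx hy =>
    simp only [star_mul, skew_mul, hx, hy, star_add, map_add, map_mul, kInvAct_star]
    abel

end Oq

/-- The Podleś sphere `O_q(S_t²)`, `t = q^a - q^(-a)`: the left coideal *-subalgebra of all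
`x ∈ O_q(SU(2))` with `R(B_t) ▷ x = ε(B_t) x`. -/
def Podles (q : Param) (a : ℝ) : StarSubalgebra ℂ (Oq q) where
  carrier := {x | Oq.RBAct q a x = Oq.epsB q a • x}
  mul_mem' := by
    intro x y hx hy
    have key : ∀ z, Oq.RBAct q a z = Oq.epsB q a • z ↔ Oq.skew q a z = 0 := fun z => by
      simp [Oq.skew, sub_eq_zero]
    simp only [Set.mem_ofPred_eq, key] at *
    simp [Oq.skew_mul, hx, hy]
  add_mem' := by
    intro x y hx hy
    simp only [Set.mem_ofPred_eq] at *
    rw [map_add, hx, hy, smul_add]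
  algebraMap_mem' := by
    intro c
    have := Oq.skew_algebraMap (q := q) a c
    simpa [Oq.skew, sub_eq_zero] using this
  star_mem' := by
    intro x hx
    have key : ∀ z, Oq.RBAct q a z = Oq.epsB q a • z ↔ Oq.skew q a z = 0 := fun z => by
      simp [Oq.skew, sub_eq_zero]
    simp only [Set.mem_ofPred_eq, key] at *
    simp [Oq.skew_star, hx]

/-! ### The module of finitely supported functions on the weights `[a + m]`, `m ∈ ℤ` -/

/-- `q^(a + m)` as a complex number. -/
def wt (q : Param) (a : ℝ) (m : ℤ) : ℂ := (((q : ℝ) ^ (a + m) : ℝ) : ℂ)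

/-- `{a + m}` as a complex number. -/
def curC (q : Param) (a : ℝ) (m : ℤ) : ℂ := wt q a m + (wt q a m)⁻¹

/-- The operator `(T f) m = u m * f (m + 1) + d m * f (m - 1)`. -/
def shiftOp (u d : ℤ → ℂ) : Module.End ℂ (ℤ →₀ ℂ) :=
  Finsupp.linearCombination ℂ fun m =>
    Finsupp.single (m - 1) (u (m - 1)) + Finsupp.single (m + 1) (d (m + 1))

@[simp] theorem shiftOp_apply (u d : ℤ → ℂ) (f : ℤ →₀ ℂ) (m : ℤ) :
    shiftOp u d f m = u m * f (m + 1) + d m * f (m - 1) := by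
  induction f using Finsupp.induction_linear with
  | zero => simp
  | add f g hf hg => simp only [map_add, Finsupp.add_apply, hf, hg]; ring
  | single k c =>
    simp only [shiftOp, Finsupp.linearCombination_single, Finsupp.smul_apply, Finsupp.add_apply,
      Finsupp.single_apply, smul_eq_mul]
    have e1 : (k - 1 = m) ↔ (k = m + 1) := by omega
    have e2 : (k + 1 = m) ↔ (k = m - 1) := by omega
    simp only [e1, e2]
    split_ifs <;> subst_vars <;> simp_all <;> ring

/-- The action `x ▷ h = h₍₁₎ (x, h₍₂₎)` of the generators on functions of the weights. A function
`h` of `i R(B_t)` is sent by the fundamental corepresentation `(α, -q γ*; γ, α*)` to the matrix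
`h(N)`, `N = (q⁻¹ [y], -i; i, q [y])` with `y = a + m`, whose eigenvalues are `[y + 1]` and
`[y - 1]`. -/
def genAct (q : Param) (a : ℝ) : Gen → Module.End ℂ (ℤ →₀ ℂ)
  | .α => shiftOp (fun m => (wt q a m)⁻¹ / curC q a m) (fun m => wt q a m / curC q a m)
  | .αs => shiftOp (fun m => wt q a m / curC q a m) (fun m => (wt q a m)⁻¹ / curC q a m)
  | .γ => shiftOp (fun m => Complex.I / curC q a m) (fun m => -Complex.I / curC q a m)
  | .γs => shiftOp (fun m => (qc q)⁻¹ * Complex.I / curC q a m)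
      (fun m => -((qc q)⁻¹ * Complex.I) / curC q a m)

theorem wt_ne (q : Param) (a : ℝ) (m : ℤ) : wt q a m ≠ 0 := by
  simp only [wt, ne_eq, Complex.ofReal_eq_zero]
  exact (Real.rpow_pos_of_pos q.2.1 _).ne'

theorem wt_add_one (q : Param) (a : ℝ) (m : ℤ) : wt q a (m + 1) = qc q * wt q a m := by
  simp only [wt, qc, ← Complex.ofReal_mul]
  congr 1
  rw [show a + ((m + 1 : ℤ) : ℝ) = 1 + (a + m) by push_cast; ring, Real.rpow_add q.2.1,
    Real.rpow_one]

theorem wt_sub_one (q : Param) (a : ℝ) (m : ℤ) : wt q a (m - 1) = (qc q)⁻¹ * wt q a m := by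
  have h := wt_add_one q a (m - 1)
  rw [sub_add_cancel] at h
  rw [h, inv_mul_cancel_left₀ (Oq.qc_ne q)]

theorem curC_ne (q : Param) (a : ℝ) (m : ℤ) : curC q a m ≠ 0 := by
  have h : 0 < (q : ℝ) ^ (a + m) := Real.rpow_pos_of_pos q.2.1 _
  have : curC q a m = (((q : ℝ) ^ (a + m) + ((q : ℝ) ^ (a + m))⁻¹ : ℝ) : ℂ) := by
    simp [curC, wt]
  rw [this, ne_eq, Complex.ofReal_eq_zero]
  positivity

theorem sq_ne (q : Param) (a : ℝ) (m : ℤ) : wt q a m ^ 2 + 1 ≠ 0 := by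
  have h := mul_ne_zero (curC_ne q a m) (wt_ne q a m)
  rw [curC, add_mul, inv_mul_cancel₀ (wt_ne q a m)] at h
  rwa [pow_two]

theorem genAct_rel (q : Param) (a : ℝ) : GenRel (qc q) (genAct q a) := by
  have hq := Oq.qc_ne q
  constructor <;> refine LinearMap.ext fun f => Finsupp.ext fun m => ?_
  all_goals
    have hE := wt_ne q a m
    have h0 := sq_ne q a m
    have h1 := sq_ne q a (m + 1)
    have h2 := sq_ne q a (m - 1)
    have e1 : m + 1 - 1 = m := by ring
    have e2 : m - 1 + 1 = m := by ring
    simp [genAct, curC, wt_add_one, wt_sub_one, e1, e2] at h1 h2 ⊢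
    generalize wt q a m = E at *
    generalize qc q = c at *
    have h3 : E ^ 2 + c ^ 2 ≠ 0 := by
      intro h
      apply h2
      field_simp
      linear_combination h
    have h4 : c ^ 2 * E ^ 2 + 1 ≠ 0 := by rwa [mul_pow] at h1
    have h5 : E ^ 2 * c ^ 2 + 1 ≠ 0 := by rwa [mul_comm]
    have h6 : c ^ 2 + E ^ 2 ≠ 0 := by rwa [add_comm]
    have hI := Complex.I_sq
    field_simp
    try simp only [hI]
    try ring


/-- `O_q(SU(2))` acting on finitely supported functions of the weights `[a + m]`, by
`x ▷ h = h₍₁₎ (x, h₍₂₎)`. -/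
def act (q : Param) (a : ℝ) : Oq q →ₐ[ℂ] Module.End ℂ (ℤ →₀ ℂ) :=
  Oq.lift (genAct q a) (genAct_rel q a)

/-! #### The elements of the Podleś sphere preserve the even weights and act at weight `[a]`
through the counit -/

theorem brk_wt (q : Param) (a : ℝ) (m : ℤ) :
    (brk q (a + m) : ℂ) = (wt q a m - (wt q a m)⁻¹) / (qc q - (qc q)⁻¹) := by
  rw [brk, Real.rpow_neg q.2.1.le]
  simp [wt, qc]

theorem brk_injective (q : Param) : Function.Injective (brk q) := by
  have h0 := q.2.1
  have h1 := q.2.2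
  have hd : ((q : ℝ) - (q : ℝ)⁻¹) < 0 := by
    have := (one_lt_inv₀ h0).2 h1
    linarith
  have : StrictMono (brk q) := by
    intro x y hxy
    have e1 := Real.rpow_lt_rpow_of_exponent_gt h0 h1 hxy
    have e2 := Real.rpow_lt_rpow_of_exponent_gt h0 h1 (neg_lt_neg hxy)
    unfold brk
    rw [div_lt_div_right_of_neg hd]
    linarith
  exact this.injective

theorem qdiff_ne (q : Param) : qc q - (qc q)⁻¹ ≠ 0 := by
  have h0 := q.2.1
  have h1 := q.2.2
  have hd : ((q : ℝ) - (q : ℝ)⁻¹) ≠ 0 := by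
    have := (one_lt_inv₀ h0).2 h1
    linarith
  have : qc q - (qc q)⁻¹ = (((q : ℝ) - (q : ℝ)⁻¹ : ℝ) : ℂ) := by simp [qc]
  rw [this]; exact_mod_cast hd

/-- Elements of weight `[a + m]` for `i R(B_t) ▷`, with what is needed of their action. -/
def wtSpace (q : Param) (a : ℝ) (m : ℤ) : Submodule ℂ (Oq q) where
  carrier := {x | Oq.RBAct q a x = (-(Complex.I * (brk q (a + m) : ℂ))) • x ∧
    (∀ f, act q a x f 0 = Oq.counit q x * f m) ∧
    ∀ (p : ℤ) (f : ℤ →₀ ℂ), (∀ k, Odd (k + p) → f k = 0) → ∀ n, Odd (n + p + m) → act q a x f n = 0}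
  zero_mem' := by simp
  add_mem' := by
    rintro x y ⟨h1, h2, h3⟩ ⟨k1, k2, k3⟩
    refine ⟨by simp [h1, k1], fun f => by simp [h2, k2, add_mul], fun p f hf n hn => ?_⟩
    simp [h3 p f hf n hn, k3 p f hf n hn]
  smul_mem' := by
    rintro c x ⟨h1, h2, h3⟩
    refine ⟨by rw [map_smul, h1, smul_comm], fun f => by simp [h2, mul_assoc], fun p f hf n hn => ?_⟩
    simp [h3 p f hf n hn]

theorem ladder (q : Param) (a : ℝ) (m : ℤ) (x u1 u2 : Oq q) (A B : ℤ → ℂ)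
    (hx : x ∈ wtSpace q a m)
    (hs1 : Oq.skew q a u1 = u2 - (Complex.I * (brk q a : ℂ) * ((qc q)⁻¹ - 1)) • u1)
    (hs2 : Oq.skew q a u2 = -u1 - (Complex.I * (brk q a : ℂ) * (qc q - 1)) • u2)
    (hk1 : Oq.kInvAct q u1 = (qc q)⁻¹ • u1) (hk2 : Oq.kInvAct q u2 = qc q • u2)
    (ha1 : ∀ f n, act q a u1 f n =
      (A n * (wt q a n)⁻¹ * f (n + 1) + B n * wt q a n * f (n - 1)) / curC q a n)
    (ha2 : ∀ f n, act q a u2 f n =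
      (-Complex.I * A n * f (n + 1) + Complex.I * B n * f (n - 1)) / curC q a n)
    (hA : ∀ n, A n = Oq.counit q u1 + Complex.I * wt q a n * Oq.counit q u2)
    (hB : ∀ n, B n = Oq.counit q u1 - Complex.I * (wt q a n)⁻¹ * Oq.counit q u2) :
    x * u1 ∈ (⨆ k, wtSpace q a k) ∧ x * u2 ∈ (⨆ k, wtSpace q a k) := by
  obtain ⟨h1, h2, h3⟩ := hx
  have hE := wt_ne q a m
  have hc := curC_ne q a m
  have hq := Oq.qc_ne q
  have hI := Complex.I_sq
  have hsq := sq_ne q a m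
  have hd := qdiff_ne q
  have hxs : Oq.skew q a x =
      (-(Complex.I * (brk q (a + m) : ℂ)) + Complex.I * (brk q a : ℂ)) • x := by
    simp [Oq.skew, h1, Oq.epsB, add_smul]
  have hR : ∀ y, Oq.RBAct q a y = Oq.skew q a y - (Complex.I * (brk q a : ℂ)) • y := by
    intro y; simp [Oq.skew, Oq.epsB]
  have parity : ∀ (c : ℂ) (ε : ℤ) (hε : Odd ε), ∀ (p : ℤ) (f : ℤ →₀ ℂ),
      (∀ k, Odd (k + p) → f k = 0) → ∀ n, Odd (n + p + (m + ε)) →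
        act q a (x * (u1 + c • u2)) f n = 0 := by
    intro c ε hε p f hf n hn
    rw [map_mul, Module.End.mul_apply]
    refine h3 (p + 1) _ (fun k hk => ?_) n ?_
    · have o1 : Odd (k + 1 + p) := by convert hk using 1; ring
      have o2 : Odd (k - 1 + p) := by
        obtain ⟨r, hr⟩ := hk
        exact ⟨r - 1, by omega⟩
      simp [ha1, ha2, hf _ o1, hf _ o2]
    · obtain ⟨r, hr⟩ := hn
      obtain ⟨r', hr'⟩ := hε
      exact ⟨r - r', by omega⟩
  have hd' : qc q ^ 2 - 1 ≠ 0 := by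
    intro h
    apply hd
    field_simp
    simpa using h
  have hp : x * (u1 + (Complex.I * wt q a m) • u2) ∈ wtSpace q a (m + 1) := by
    refine ⟨?_, fun f => ?_, parity _ 1 (by decide)⟩
    · rw [hR, Oq.skew_mul, hxs]
      simp only [map_add, map_smul, hs1, hs2, hk1, hk2, brk_wt, wt_add_one, smul_mul_assoc,
        mul_add, mul_sub, mul_smul_comm, smul_add, smul_sub, smul_smul, mul_neg, smul_neg]
      match_scalars <;> field_simp <;> (try simp only [hI]) <;> ring
    · rw [map_mul, Module.End.mul_apply, h2]
      simp only [map_add, map_smul, LinearMap.add_apply, LinearMap.smul_apply, Finsupp.add_apply,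
        Finsupp.smul_apply, ha1, ha2, smul_eq_mul, map_mul]
      have : Oq.counit q u1 + Complex.I * wt q a m * Oq.counit q u2 = A m := (hA m).symm
      rw [this]
      unfold curC
      field_simp
      simp only [hI]
      ring
  have hm : x * (u1 + (-(Complex.I * (wt q a m)⁻¹)) • u2) ∈ wtSpace q a (m + -1) := by
    refine ⟨?_, fun f => ?_, parity _ (-1) (by decide)⟩
    · rw [hR, Oq.skew_mul, hxs, ← sub_eq_add_neg m 1]
      simp only [map_add, map_smul, hs1, hs2, hk1, hk2, brk_wt, wt_sub_one, smul_mul_assoc,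
        mul_add, mul_sub, mul_smul_comm, smul_add, smul_sub, smul_smul, mul_neg, smul_neg]
      match_scalars <;> field_simp <;> (try simp only [hI]) <;> ring
    · rw [map_mul, Module.End.mul_apply, h2]
      simp only [map_add, map_smul, LinearMap.add_apply, LinearMap.smul_apply, Finsupp.add_apply,
        Finsupp.smul_apply, ha1, ha2, smul_eq_mul, map_mul]
      have : Oq.counit q u1 + -(Complex.I * (wt q a m)⁻¹) * Oq.counit q u2 = B m := by
        rw [hB m]; ring
      rw [this]
      unfold curC
      field_simp
      simp only [hI]
      ring
  have hp' := Submodule.mem_iSup_of_mem (p := wtSpace q a) _ hp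
  have hm' := Submodule.mem_iSup_of_mem (p := wtSpace q a) _ hm
  have e1 : x * u1 = ((wt q a m)⁻¹ / curC q a m) • (x * (u1 + (Complex.I * wt q a m) • u2)) +
      (wt q a m / curC q a m) • (x * (u1 + (-(Complex.I * (wt q a m)⁻¹)) • u2)) := by
    simp only [mul_add, mul_smul_comm, smul_add, smul_smul]
    match_scalars
    · field_simp
      rw [curC]
      field_simp
      ring
    · field_simp
      ring
  have e2 : x * u2 = (-Complex.I / curC q a m) • (x * (u1 + (Complex.I * wt q a m) • u2)) +
      (Complex.I / curC q a m) • (x * (u1 + (-(Complex.I * (wt q a m)⁻¹)) • u2)) := by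
    simp only [mul_add, mul_smul_comm, smul_add, smul_smul]
    match_scalars
    · field_simp
      rw [curC]
      field_simp
      simp only [hI]
      ring
    · field_simp
      ring
  constructor
  · rw [e1]
    exact add_mem (Submodule.smul_mem _ _ hp') (Submodule.smul_mem _ _ hm')
  · rw [e2]
    exact add_mem (Submodule.smul_mem _ _ hp') (Submodule.smul_mem _ _ hm')

theorem iSup_wtSpace (q : Param) (a : ℝ) : (⨆ k, wtSpace q a k) = ⊤ := by
  have hI := Complex.I_sq
  have hgen : ∀ g m x, x ∈ wtSpace q a m → x * Oq.gen q g ∈ (⨆ k, wtSpace q a k) := by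
    intro g m x hx
    have hq := Oq.qc_ne q
    have r1 := ladder q a m x (Oq.gen q .α) (-qc q • Oq.gen q .γs) (fun _ => 1) (fun _ => 1) hx
      (by simp [Oq.skew_gen]) (by simp [Oq.skew_gen, smul_sub, smul_smul, hq]; module)
      (by simp [Oq.kInvAct]) (by simp [Oq.kInvAct, smul_smul])
      (by intro f n; simp [act, genAct]; ring)
      (by intro f n; simp [act, genAct]; field_simp; ring)
      (by simp [Oq.counit]) (by simp [Oq.counit])
    have r2 := ladder q a m x (Oq.gen q .γ) (Oq.gen q .αs) (fun n => Complex.I * wt q a n)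
      (fun n => -(Complex.I * (wt q a n)⁻¹)) hx
      (by simp [Oq.skew_gen]) (by simp [Oq.skew_gen])
      (by simp [Oq.kInvAct]) (by simp [Oq.kInvAct])
      (by intro f n; have := wt_ne q a n; simp [act, genAct]; field_simp)
      (by intro f n; simp [act, genAct]; ring_nf; simp [hI])
      (by simp [Oq.counit]) (by simp [Oq.counit])
    cases g
    · exact r1.1
    · exact r2.2
    · exact r2.1
    · have h := Submodule.smul_mem _ (-(qc q)⁻¹) r1.2
      simpa [smul_smul, hq] using h
  have hmul : ∀ y x, x ∈ (⨆ k, wtSpace q a k) → x * y ∈ (⨆ k, wtSpace q a k) := by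
    intro y
    induction y using Oq.induction with
    | hc c =>
      intro x hx
      rw [← Algebra.commutes, ← Algebra.smul_def]
      exact Submodule.smul_mem _ _ hx
    | hg g =>
      intro x hx
      induction hx using Submodule.iSup_induction' with
      | mem i x hx => exact hgen g i x hx
      | zero => simp
      | add x y _ _ hx hy => rw [add_mul]; exact add_mem hx hy
    | ha y z hy hz => intro x hx; rw [mul_add]; exact add_mem (hy x hx) (hz x hx)
    | hm y z hy hz => intro x hx; rw [← mul_assoc]; exact hz _ (hy x hx)
  have h1 : (1 : Oq q) ∈ wtSpace q a 0 := by
    refine ⟨?_, by simp, ?_⟩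
    · have := Oq.skew_algebraMap (q := q) a 1
      simpa [Oq.skew, Oq.epsB, sub_eq_zero, add_eq_zero_iff_eq_neg] using this
    · intro p f hf n hn
      simpa using hf n (by simpa using hn)
  rw [eq_top_iff]
  intro y _
  simpa using hmul y 1 (Submodule.mem_iSup_of_mem _ h1)

theorem mem_wtSpace_zero {q : Param} {a : ℝ} {b : Oq q} (hb : b ∈ Podles q a) :
    b ∈ wtSpace q a 0 := by
  have hinj : Function.Injective fun m : ℤ => -(Complex.I * (brk q (a + m) : ℂ)) := by
    intro m n h
    have h2 : (brk q (a + m) : ℂ) = brk q (a + n) :=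
      mul_left_cancel₀ Complex.I_ne_zero (neg_injective h)
    have h3 := brk_injective q (Complex.ofReal_injective h2)
    exact_mod_cast add_left_cancel h3
  have hind := (Module.End.eigenspaces_iSupIndep (Oq.RBAct q a)).comp hinj
  have hle : ∀ m, wtSpace q a m ≤
      Module.End.eigenspace (Oq.RBAct q a) (-(Complex.I * (brk q (a + m) : ℂ))) := fun m x hx =>
    Module.End.mem_eigenspace_iff.2 hx.1
  have hb0 : b ∈ Module.End.eigenspace (Oq.RBAct q a) (-(Complex.I * (brk q (a + (0 : ℤ)) : ℂ))) := by
    rw [Module.End.mem_eigenspace_iff]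
    have hb' : Oq.RBAct q a b = Oq.epsB q a • b := hb
    simpa [Oq.epsB] using hb'
  have hmem : b ∈ (⨆ k, wtSpace q a k) := by rw [iSup_wtSpace]; trivial
  rw [iSup_split_single _ (0 : ℤ)] at hmem
  obtain ⟨x, hx, y, hy, rfl⟩ := Submodule.mem_sup.1 hmem
  have hy0 : y ∈ Module.End.eigenspace (Oq.RBAct q a) (-(Complex.I * (brk q (a + (0 : ℤ)) : ℂ))) := by
    simpa using sub_mem hb0 (hle 0 hx)
  have hy1 : y ∈ ⨆ k, ⨆ (_ : k ≠ 0),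
      Module.End.eigenspace (Oq.RBAct q a) (-(Complex.I * (brk q (a + (k : ℤ)) : ℂ))) :=
    iSup₂_mono (fun k _ => hle k) hy
  have := Submodule.disjoint_def.1 (hind 0) y hy0 hy1
  rw [this, add_zero]
  exact hx

/-! ### The discrete series representations, the cocycle -/

/-- The space of `D₂⁺ ⊕ D₂⁻`: it has a basis `e n`, `n ≠ 0`, where `e n` is the indicator function
of the weight `[a + 2 n]`; `D₂⁺` is the span of the `e n` with `n > 0`, and `D₂⁻` that of the `e n`
with `n < 0`. -/
def D2 (_q : Param) (_a : ℝ) : Type := {n : ℤ // n ≠ 0} →₀ ℂ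

instance (q : Param) (a : ℝ) : AddCommGroup (D2 q a) :=
  inferInstanceAs (AddCommGroup ({n : ℤ // n ≠ 0} →₀ ℂ))
instance (q : Param) (a : ℝ) : Module ℂ (D2 q a) :=
  inferInstanceAs (Module ℂ ({n : ℤ // n ≠ 0} →₀ ℂ))

namespace D2

variable {q : Param} {a : ℝ}

/-- The coordinates of a vector in the basis `e n`. -/
def coord (f : D2 q a) : {n : ℤ // n ≠ 0} →₀ ℂ := f

/-- The squared norm of `e n`. -/
def normSq (q : Param) (a : ℝ) (n : {n : ℤ // n ≠ 0}) : ℝ :=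
  cur q (a + 2) / (cur q a * (cur q (2 * a + 1) + q + (q : ℝ)⁻¹)) *
    (cur q (a + 2 * (n : ℤ)) /
      (((q : ℝ)⁻¹ - q) * |(q : ℝ) ^ (-(n : ℤ)) - (q : ℝ) ^ (n : ℤ)| * cur q (a + (n : ℤ))))

theorem cur_pos (q : Param) (x : ℝ) : 0 < cur q x :=
  add_pos (Real.rpow_pos_of_pos q.2.1 _) (Real.rpow_pos_of_pos q.2.1 _)

theorem normSq_pos (q : Param) (a : ℝ) (n : {n : ℤ // n ≠ 0}) : 0 < normSq q a n := by
  have h0 := q.2.1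
  have h1 := q.2.2
  have hd : 0 < (q : ℝ)⁻¹ - q := by
    have := (one_lt_inv₀ h0).2 h1
    linarith
  have hn : 0 < |(q : ℝ) ^ (-(n : ℤ)) - (q : ℝ) ^ (n : ℤ)| := by
    rw [abs_pos, sub_ne_zero]
    intro h
    have := zpow_right_injective₀ h0 h1.ne h
    have := n.2
    omega
  have hi := inv_pos.2 h0
  have := cur_pos q a
  have := cur_pos q (a + 2)
  have := cur_pos q (2 * a + 1)
  have := cur_pos q (a + 2 * (n : ℤ))
  have := cur_pos q (a + (n : ℤ))
  unfold normSq
  have h2 : 0 < cur q (2 * a + 1) + q + (q : ℝ)⁻¹ := by linarith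
  positivity

/-- The summand `D₂⁺`. -/
def plus (q : Param) (a : ℝ) : Submodule ℂ (D2 q a) where
  carrier := {f | ∀ n : {n : ℤ // n ≠ 0}, (n : ℤ) < 0 → f.coord n = 0}
  zero_mem' := fun _ _ => rfl
  add_mem' := fun {f g} hf hg n hn => by
    change f.coord n + g.coord n = 0
    rw [hf n hn, hg n hn, add_zero]
  smul_mem' := fun c f hf n hn => by
    change c * f.coord n = 0
    rw [hf n hn, mul_zero]

/-- The summand `D₂⁻`. -/
def minus (q : Param) (a : ℝ) : Submodule ℂ (D2 q a) where
  carrier := {f | ∀ n : {n : ℤ // n ≠ 0}, 0 < (n : ℤ) → f.coord n = 0}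
  zero_mem' := fun _ _ => rfl
  add_mem' := fun {f g} hf hg n hn => by
    change f.coord n + g.coord n = 0
    rw [hf n hn, hg n hn, add_zero]
  smul_mem' := fun c f hf n hn => by
    change c * f.coord n = 0
    rw [hf n hn, mul_zero]

/-- The inner product for which the `e n` are orthogonal with squared norms `normSq`; it is
conjugate linear in the first variable. -/
@[reducible] def core (q : Param) (a : ℝ) : InnerProductSpace.Core ℂ (D2 q a) where
  inner f g := f.coord.sum fun n c => (normSq q a n : ℂ) * conj c * g.coord n
  conj_inner_symm f g := by
    change conj (Finsupp.sum _ _) = Finsupp.sum _ _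
    rw [Finsupp.sum_of_support_subset (s := f.coord.support ∪ g.coord.support) _
        Finset.subset_union_right _ (by simp),
      Finsupp.sum_of_support_subset (s := f.coord.support ∪ g.coord.support) _
        Finset.subset_union_left _ (by simp), map_sum]
    refine Finset.sum_congr rfl fun n _ => ?_
    simp
    ring
  re_inner_nonneg f := by
    change 0 ≤ RCLike.re (Finsupp.sum _ _)
    rw [Finsupp.sum, map_sum]
    refine Finset.sum_nonneg fun n _ => ?_
    have h : (normSq q a n : ℂ) * conj (f.coord n) * f.coord n =
        ((normSq q a n * Complex.normSq (f.coord n) : ℝ) : ℂ) := by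
      rw [mul_assoc, ← Complex.normSq_eq_conj_mul_self]; push_cast; rfl
    rw [h]
    change 0 ≤ (Complex.ofReal _).re
    rw [Complex.ofReal_re]
    exact mul_nonneg (normSq_pos q a n).le (Complex.normSq_nonneg _)
  add_left f g h := by
    change Finsupp.sum (f.coord + g.coord) _ = _
    rw [Finsupp.sum_add_index' (by simp) (by intro n x y; simp; ring)]
  smul_left f g c := by
    change Finsupp.sum (c • f.coord) _ = _
    rw [Finsupp.sum_smul_index' (by simp)]
    change _ = conj c * Finsupp.sum _ _
    rw [Finsupp.mul_sum]
    refine Finsupp.sum_congr fun n _ => ?_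
    simp
    ring
  definite f h := by
    change Finsupp.sum f.coord _ = 0 at h
    have h2 : ((f.coord.sum fun n c => normSq q a n * Complex.normSq c : ℝ) : ℂ) = 0 := by
      rw [← h, Finsupp.sum, Finsupp.sum, Complex.ofReal_sum]
      refine Finset.sum_congr rfl fun n _ => ?_
      rw [mul_assoc, ← Complex.normSq_eq_conj_mul_self]; push_cast; rfl
    rw [Complex.ofReal_eq_zero, Finsupp.sum, Finset.sum_eq_zero_iff_of_nonneg
      (fun n _ => mul_nonneg (normSq_pos q a n).le (Complex.normSq_nonneg _))] at h2
    refine Finsupp.ext (f := f.coord) (g := 0) fun n => ?_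
    by_contra hn
    have := h2 n (Finsupp.mem_support_iff.2 hn)
    rcases mul_eq_zero.1 this with h3 | h3
    · exact (normSq_pos q a n).ne' h3
    · exact hn (Complex.normSq_eq_zero.1 h3)

instance (q : Param) (a : ℝ) : NormedAddCommGroup (D2 q a) := (core q a).toNormedAddCommGroup
instance (q : Param) (a : ℝ) : InnerProductSpace ℂ (D2 q a) := InnerProductSpace.ofCore (core q a).toCore

theorem two_mul_inj : Function.Injective fun n : {n : ℤ // n ≠ 0} => 2 * (n : ℤ) := by
  intro m n h
  ext
  simpa using h

/-- The inclusion `e n ↦ δ_{2 n}` into the functions of the weights. -/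
def incl (q : Param) (a : ℝ) : D2 q a →ₗ[ℂ] (ℤ →₀ ℂ) :=
  Finsupp.lmapDomain ℂ ℂ fun n : {n : ℤ // n ≠ 0} => 2 * (n : ℤ)

/-- The restriction of a function to the weights `[a + 2 n]`, `n ≠ 0`. -/
def restr (q : Param) (a : ℝ) : (ℤ →₀ ℂ) →ₗ[ℂ] D2 q a :=
  Finsupp.lcomapDomain (fun n : {n : ℤ // n ≠ 0} => 2 * (n : ℤ)) two_mul_inj

theorem restr_incl (f : D2 q a) : restr q a (incl q a f) = f :=
  Finsupp.comapDomain_mapDomain _ two_mul_inj f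

theorem incl_restr (g : ℤ →₀ ℂ) (h0 : g 0 = 0) (h1 : ∀ k, Odd k → g k = 0) :
    incl q a (restr q a g) = g := by
  refine Finsupp.mapDomain_comapDomain _ two_mul_inj g fun k hk => ?_
  rcases Int.even_or_odd k with h | h
  · obtain ⟨n, rfl⟩ := h
    refine ⟨⟨n, ?_⟩, by simp; ring⟩
    rintro rfl
    simp [h0] at hk
  · simp [h1 k h] at hk

theorem incl_zero (f : D2 q a) : incl q a f 0 = 0 := by
  refine Finsupp.mapDomain_of_notMem_range _ _ ?_
  rintro ⟨n, hn⟩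
  have := n.2
  simp at hn
  omega

theorem incl_odd (f : D2 q a) (k : ℤ) (hk : Odd k) : incl q a f k = 0 := by
  refine Finsupp.mapDomain_of_notMem_range _ _ ?_
  rintro ⟨n, hn⟩
  obtain ⟨r, rfl⟩ := hk
  simp at hn
  omega

theorem incl_restr_act (b : Podles q a) (f : D2 q a) :
    incl q a (restr q a (act q a b (incl q a f))) = act q a b (incl q a f) := by
  obtain ⟨-, h2, h3⟩ := mem_wtSpace_zero b.2
  refine incl_restr _ (by rw [h2, incl_zero, mul_zero]) fun k hk => ?_
  exact h3 0 _ (fun j hj => incl_odd _ _ (by simpa using hj)) k (by simpa using hk)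

end D2

/-- The representation of the Podleś sphere on `D₂⁺ ⊕ D₂⁻`: the restriction of `▷` to the functions
that are supported on the weights `[a + 2 n]`, `n ≠ 0`. -/
def rep (q : Param) (a : ℝ) : Podles q a →ₐ[ℂ] Module.End ℂ (D2 q a) :=
  AlgHom.ofLinearMap
    { toFun := fun b => D2.restr q a ∘ₗ act q a b ∘ₗ D2.incl q a
      map_add' := fun b c => by ext; simp
      map_smul' := fun b c => by ext; simp }
    (by ext f; simp [D2.restr_incl])
    (fun b c => by
      refine LinearMap.ext fun f => ?_
      simp [D2.incl_restr_act])

/-- The restriction of the counit to the Podleś sphere. -/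
def eps (q : Param) (a : ℝ) : Podles q a →ₐ[ℂ] ℂ :=
  (Oq.counit q).comp (Podles q a).subtype.toAlgHom

/-- The cocycle `C(b) = b ▷ e_a - ε(b) e_a`, where `e_a` is the indicator function of `[a]`. -/
def cocycle (q : Param) (a : ℝ) : Podles q a →ₗ[ℂ] D2 q a where
  toFun b := D2.restr q a
    (act q a b (Finsupp.single 0 1) - Oq.counit q b • Finsupp.single 0 1)
  map_add' b c := by
    rw [← map_add]
    congr 1
    simp [add_smul]
    abel
  map_smul' c b := by
    rw [RingHom.id_apply, ← map_smul]
    congr 1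
    simp [smul_sub]

theorem incl_cocycle {q : Param} {a : ℝ} (b : Podles q a) : D2.incl q a (cocycle q a b) =
    act q a b (Finsupp.single 0 1) - Oq.counit q b • Finsupp.single 0 1 := by
  obtain ⟨-, h2, h3⟩ := mem_wtSpace_zero b.2
  refine D2.incl_restr _ ?_ fun k hk => ?_
  · simp [h2]
  · have hs : ∀ k : ℤ, Odd k → Finsupp.single (0 : ℤ) (1 : ℂ) k = 0 := fun k hk => by
      rw [Finsupp.single_apply, if_neg]
      rintro rfl
      simp at hk
    have := h3 0 (Finsupp.single 0 1) (fun j hj => hs j (by simpa using hj)) k (by simpa using hk)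
    rw [Finsupp.sub_apply, Finsupp.smul_apply, this, hs k hk, smul_zero, sub_zero]

/-! ### Cocycles and their Gaussian part -/

section Gaussian

variable {B H : Type*} [Ring B] [Algebra ℂ B] [NormedAddCommGroup H] [InnerProductSpace ℂ H]

/-- `π` is a *-representation on the pre-Hilbert space `H`: `π(b*)` is the adjoint of `π(b)`. -/
def IsStarRep [Star B] (π : B →ₐ[ℂ] Module.End ℂ H) : Prop :=
  ∀ (b : B) (v w : H), ⟪π (star b) v, w⟫_ℂ = ⟪v, π b w⟫_ℂ

/-- `C` is a `(π, ε)`-1-cocycle. -/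
def IsOneCocycle (π : B →ₐ[ℂ] Module.End ℂ H) (ε : B →ₐ[ℂ] ℂ) (C : B →ₗ[ℂ] H) : Prop :=
  ∀ b c : B, C (b * c) = π b (C c) + ε c • C b

/-- `H_G`, the orthogonal complement of the vectors `(π(b) - ε(b)) C(c)` in the completion. -/
abbrev gaussSpace (π : B →ₐ[ℂ] Module.End ℂ H) (ε : B →ₐ[ℂ] ℂ) (C : B →ₗ[ℂ] H) :
    Submodule ℂ (UniformSpace.Completion H) :=
  (Submodule.span ℂ
    {v | ∃ b c : B, v = ((π b (C c) - ε b • C c : H) : UniformSpace.Completion H)})ᗮ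

/-- `P_G`, the orthogonal projection of the completion onto `H_G`. -/
def gaussProj (π : B →ₐ[ℂ] Module.End ℂ H) (ε : B →ₐ[ℂ] ℂ) (C : B →ₗ[ℂ] H) :
    UniformSpace.Completion H →L[ℂ] UniformSpace.Completion H :=
  (gaussSpace π ε C).starProjection

/-- `C` is purely non-Gaussian: the image of `H` under `P_G` is zero. -/
def IsPurelyNonGaussian (π : B →ₐ[ℂ] Module.End ℂ H) (ε : B →ₐ[ℂ] ℂ) (C : B →ₗ[ℂ] H) : Prop :=
  ∀ v : H, gaussProj π ε C (v : UniformSpace.Completion H) = 0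

end Gaussian

end QPodles

end

noncomputable section

namespace QPodles

/-! Idea of the proof. If `x` has weight `[y]`, `y = a + m`, then `R(B_t)` acts on the products of
`x` with the two columns of the fundamental corepresentation by a 2×2 matrix with eigenvectors at
the weights `[y + 1]` and `[y - 1]`. These eigenvectors are products of `x` with ladder elements
`stepEl`. Every element of `O_q(SU(2))` is a sum of ladder products starting from `1`, and
independence of the eigenspaces leaves, for an element of the Podleś sphere, only the products along
closed paths (`mem_of_mem_Podles`). Statements about the sphere are thus proved one ladder step at a
time.

Invariance: by `act_stepEl` each coefficient of a ladder element is a product of linear factors, and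
the coefficient that would lead across the current weight is zero there. A closed path therefore
never carries a function supported on one side of `[a]` to `[a]` or beyond.

*-property: two relations are combined. On the whole module, `x*` is adjoint to `k⁻¹ ▷ x` for the
form with weights `{a + m}` (`curForm_act_star`). On the sphere, multiplication by `[a + k] - [a]`
intertwines `b` and `k⁻¹ ▷ b` up to scaling (`act_twist`). Hence `b*` is adjoint to `b` for the
weights `{a + 2n} / ([a + 2n] - [a])`, which are the given norms up to a constant and a sign that
depends only on the half-line. By invariance the sign is harmless.

Cocycle: in the larger module `C` is the coboundary of `e_a`. Its range is invariant and, by a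
choice of free parameter in a product of two ladder elements, contains `e 1` and `e (-1)`, which
generate everything (`D2.eq_top_of_mem`).

No Gaussian part: since `C` is onto, the span of all `(π(b) - ε(b)) C(c)` is the span of all `(π(b)
- ε(b)) v`, again an invariant subspace. It contains `e 1` and `e (-1)` because each is an
eigenvector of some `π(b)` with eigenvalue different from `ε(b)`. So the span is already everything
before completion. -/

/-! ### Ladder elements -/

/-- The combination `s α + t γ` of the first column of the fundamental corepresentation. -/
def colOne (q : Param) (s t : ℂ) : Oq q := s • Oq.gen q .α + t • Oq.gen q .γ

/-- The combination of the second column corresponding to `colOne`. -/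
def colTwo (q : Param) (s t : ℂ) : Oq q := t • Oq.gen q .αs - (s * qc q) • Oq.gen q .γs

/-- `x * stepEl q c s t` has weight `[a + m ± 1]` if `x` has weight `[a + m]` and `c = q^(a + m)`,
respectively `c = -q^(-(a + m))`. -/
def stepEl (q : Param) (c s t : ℂ) : Oq q := colOne q s t + (Complex.I * c) • colTwo q s t

/-- The factorization drives the whole proof: one factor depends only on `s, t`, the other only on
`c`. For `c = wt q a m` the coefficient of `f (n - 1)` vanishes at `n = m`; for `c = -(wt q a m)⁻¹`
that of `f (n + 1)` does. The factor in `s, t` can be made to vanish at any one chosen place. -/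
theorem act_stepEl (q : Param) (a : ℝ) (c s t : ℂ) : act q a (stepEl q c s t) =
    shiftOp (fun n => (s + t * Complex.I * wt q a n) * ((wt q a n)⁻¹ + c) / curC q a n)
      (fun n => (s - t * Complex.I * (wt q a n)⁻¹) * (wt q a n - c) / curC q a n) := by
  refine LinearMap.ext fun f => Finsupp.ext fun n => ?_
  have hq := Oq.qc_ne q
  have hw := wt_ne q a n
  have hc := curC_ne q a n
  have hI := Complex.I_sq
  simp [act, stepEl, colOne, colTwo, genAct]
  field_simp
  ring_nf
  simp only [hI]
  ring

/-- `k⁻¹` scales the two columns by `q⁻¹` and `q`, so only their ratio `c` changes, by `q²`. -/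
theorem kInvAct_stepEl (q : Param) (c s t : ℂ) :
    Oq.kInvAct q (stepEl q c s t) = (qc q)⁻¹ • stepEl q (qc q ^ 2 * c) s t := by
  have hq := Oq.qc_ne q
  simp [stepEl, colOne, colTwo, Oq.kInvAct]
  match_scalars <;> field_simp

theorem counit_stepEl (q : Param) (c s t : ℂ) :
    Oq.counit q (stepEl q c s t) = s + Complex.I * c * t := by
  simp [stepEl, colOne, colTwo, Oq.counit]

/-! ### Weight spaces of `R(B_t)` and ladder products -/

theorem RBAct_eq_skew (q : Param) (a : ℝ) (y : Oq q) :
    Oq.RBAct q a y = Oq.skew q a y - (Complex.I * (brk q a : ℂ)) • y := by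
  simp [Oq.skew, Oq.epsB]

theorem skew_stepEl (q : Param) (a : ℝ) (c s t : ℂ) :
    Oq.skew q a (stepEl q c s t) = colTwo q s t - (Complex.I * c) • colOne q s t
      - (Complex.I * (brk q a : ℂ)) • (Oq.kInvAct q (stepEl q c s t) - stepEl q c s t) := by
  have hq := Oq.qc_ne q
  simp [stepEl, colOne, colTwo, Oq.skew_gen, Oq.kInvAct]
  match_scalars <;> field_simp <;> ring

/-- The eigenspace of `R(B_t) ▷` of weight `[a + m]`. -/
def weightSpace (q : Param) (a : ℝ) (m : ℤ) : Submodule ℂ (Oq q) :=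
  Module.End.eigenspace (Oq.RBAct q a) (-(Complex.I * (brk q (a + m) : ℂ)))

theorem mem_weightSpace_iff {q : Param} {a : ℝ} {m : ℤ} {x : Oq q} : x ∈ weightSpace q a m ↔
    Oq.RBAct q a x = (-(Complex.I * (brk q (a + m) : ℂ))) • x :=
  Module.End.mem_eigenspace_iff

theorem mem_weightSpace_zero_iff {q : Param} {a : ℝ} {x : Oq q} :
    x ∈ weightSpace q a 0 ↔ x ∈ Podles q a := by
  rw [mem_weightSpace_iff, Int.cast_zero, add_zero]
  rfl

/-- In the twisted Leibniz rule of `skew` the contributions of `[a]` cancel, and only the weight `[a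
+ m]` of `x` remains. -/
theorem RBAct_mul_stepEl {q : Param} {a : ℝ} {m : ℤ} {x : Oq q} (hx : x ∈ weightSpace q a m)
    (c s t : ℂ) : Oq.RBAct q a (x * stepEl q c s t) =
      x * (colTwo q s t - (Complex.I * c) • colOne q s t
        - (Complex.I * (brk q (a + m) : ℂ)) • Oq.kInvAct q (stepEl q c s t)) := by
  have hxs : Oq.skew q a x =
      (-(Complex.I * (brk q (a + m) : ℂ)) + Complex.I * (brk q a : ℂ)) • x := by
    simp [Oq.skew, mem_weightSpace_iff.1 hx, Oq.epsB, add_smul]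
  rw [RBAct_eq_skew, Oq.skew_mul, hxs, skew_stepEl]
  simp only [mul_sub, smul_mul_assoc, mul_smul_comm]
  module

/-- With `y = a + m`, the columns transform by `colOne ↦ colTwo - i q⁻¹ [y] colOne` and `colTwo ↦
-colOne - i q [y] colTwo`. The eigenvectors `colOne + i c colTwo` occur at `c = q^y` and `c =
-q^(-y)`, with eigenvalues `-i [y + 1]` and `-i [y - 1]`. -/
theorem mul_stepEl_up {q : Param} {a : ℝ} {m : ℤ} {x : Oq q} (hx : x ∈ weightSpace q a m)
    (s t : ℂ) : x * stepEl q (wt q a m) s t ∈ weightSpace q a (m + 1) := by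
  rw [mem_weightSpace_iff, RBAct_mul_stepEl hx, kInvAct_stepEl, ← mul_smul_comm]
  congr 1
  have hq := Oq.qc_ne q
  have hw := wt_ne q a m
  have hd := qdiff_ne q
  have hd' : qc q ^ 2 - 1 ≠ 0 := fun h => hd (by field_simp; simpa using h)
  have hI := Complex.I_sq
  simp only [stepEl, brk_wt, wt_add_one]
  match_scalars <;> field_simp <;> (try simp only [hI]) <;> ring

theorem mul_stepEl_down {q : Param} {a : ℝ} {m : ℤ} {x : Oq q} (hx : x ∈ weightSpace q a m)
    (s t : ℂ) : x * stepEl q (-(wt q a m)⁻¹) s t ∈ weightSpace q a (m - 1) := by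
  rw [mem_weightSpace_iff, RBAct_mul_stepEl hx, kInvAct_stepEl, ← mul_smul_comm]
  congr 1
  have hq := Oq.qc_ne q
  have hw := wt_ne q a m
  have hd := qdiff_ne q
  have hd' : qc q ^ 2 - 1 ≠ 0 := fun h => hd (by field_simp; simpa using h)
  have hI := Complex.I_sq
  simp only [stepEl, brk_wt, wt_sub_one]
  match_scalars <;> field_simp <;> (try simp only [hI]) <;> ring

theorem one_mem_weightSpace (q : Param) (a : ℝ) : (1 : Oq q) ∈ weightSpace q a 0 :=
  mem_weightSpace_zero_iff.2 (one_mem _)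

/-- `colOne` and `colTwo` are combinations of the two ladder elements at any weight. -/
theorem col_eq (q : Param) (a : ℝ) (m : ℤ) (s t : ℂ) :
    colOne q s t = ((wt q a m)⁻¹ / curC q a m) • stepEl q (wt q a m) s t +
      (wt q a m / curC q a m) • stepEl q (-(wt q a m)⁻¹) s t ∧
    colTwo q s t = (-Complex.I / curC q a m) • stepEl q (wt q a m) s t +
      (Complex.I / curC q a m) • stepEl q (-(wt q a m)⁻¹) s t := by
  have hw := wt_ne q a m
  have hc := curC_ne q a m
  have hI := Complex.I_sq
  have hc' : curC q a m = wt q a m + (wt q a m)⁻¹ := rfl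
  constructor <;> simp only [stepEl] <;> match_scalars <;> field_simp <;> (try simp only [hI]) <;>
    (try rw [hc']) <;> field_simp <;> ring

/-- The elements of the Podleś sphere are combinations of products of ladder elements along closed
paths of weights that start at `[a]`. -/
theorem mem_of_mem_Podles {q : Param} {a : ℝ} (V : ℤ → Submodule ℂ (Oq q)) (h1 : 1 ∈ V 0)
    (hup : ∀ m x s t, x ∈ V m → x * stepEl q (wt q a m) s t ∈ V (m + 1))
    (hdown : ∀ m x s t, x ∈ V m → x * stepEl q (-(wt q a m)⁻¹) s t ∈ V (m - 1))
    {b : Oq q} (hb : b ∈ Podles q a) : b ∈ V 0 := by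
  -- `V` alone need not be independent; intersecting with the weight spaces lets the component of
  -- `b` at weight `[a]` be isolated at the end.
  set W : ℤ → Submodule ℂ (Oq q) := fun m => V m ⊓ weightSpace q a m with hW
  have hcol : ∀ m x s t, x ∈ W m →
      x * colOne q s t ∈ (⨆ k, W k) ∧ x * colTwo q s t ∈ (⨆ k, W k) := by
    intro m x s t hx
    have hu : x * stepEl q (wt q a m) s t ∈ (⨆ k, W k) :=
      Submodule.mem_iSup_of_mem (p := W) _ ⟨hup m x s t hx.1, mul_stepEl_up hx.2 s t⟩
    have hd : x * stepEl q (-(wt q a m)⁻¹) s t ∈ (⨆ k, W k) :=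
      Submodule.mem_iSup_of_mem (p := W) _ ⟨hdown m x s t hx.1, mul_stepEl_down hx.2 s t⟩
    obtain ⟨e1, e2⟩ := col_eq q a m s t
    rw [e1, e2]
    simp only [mul_add, mul_smul_comm]
    exact ⟨add_mem (Submodule.smul_mem _ _ hu) (Submodule.smul_mem _ _ hd),
      add_mem (Submodule.smul_mem _ _ hu) (Submodule.smul_mem _ _ hd)⟩
  have hgen : ∀ g m x, x ∈ W m → x * Oq.gen q g ∈ (⨆ k, W k) := by
    intro g m x hx
    cases g
    · simpa [colOne] using (hcol m x 1 0 hx).1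
    · simpa [colTwo] using (hcol m x 0 1 hx).2
    · simpa [colOne] using (hcol m x 0 1 hx).1
    · have := Submodule.smul_mem _ (-(qc q)⁻¹) (hcol m x 1 0 hx).2
      simpa [colTwo, smul_smul, Oq.qc_ne q] using this
  have hmul : ∀ y x, x ∈ (⨆ k, W k) → x * y ∈ (⨆ k, W k) := by
    intro y
    induction y using Oq.induction with
    | hc c =>
      intro x hx
      rw [← Algebra.commutes, ← Algebra.smul_def]
      exact Submodule.smul_mem _ _ hx
    | hg g =>
      intro x hx
      induction hx using Submodule.iSup_induction' with
      | mem i x hx => exact hgen g i x hx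
      | zero => simp
      | add x y _ _ hx hy => rw [add_mul]; exact add_mem hx hy
    | ha y z hy hz => intro x hx; rw [mul_add]; exact add_mem (hy x hx) (hz x hx)
    | hm y z hy hz => intro x hx; rw [← mul_assoc]; exact hz _ (hy x hx)
  have hmem : b ∈ (⨆ k, W k) := by
    simpa using hmul b 1 (Submodule.mem_iSup_of_mem 0 ⟨h1, one_mem_weightSpace q a⟩)
  have hinj : Function.Injective fun m : ℤ => -(Complex.I * (brk q (a + m) : ℂ)) := by
    intro m n h
    have h2 : (brk q (a + m) : ℂ) = brk q (a + n) :=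
      mul_left_cancel₀ Complex.I_ne_zero (neg_injective h)
    have h3 := brk_injective q (Complex.ofReal_injective h2)
    exact_mod_cast add_left_cancel h3
  have hind : iSupIndep (weightSpace q a) :=
    (Module.End.eigenspaces_iSupIndep (Oq.RBAct q a)).comp hinj
  rw [iSup_split_single _ (0 : ℤ)] at hmem
  obtain ⟨x, hx, y, hy, rfl⟩ := Submodule.mem_sup.1 hmem
  -- The part `y` coming from the other weights also has weight `[a]`, being `b - x`, so it vanishes
  -- by independence.
  have hy0 : y ∈ weightSpace q a 0 := by
    simpa using sub_mem (mem_weightSpace_zero_iff.2 hb) hx.2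
  have hy1 : y ∈ ⨆ k, ⨆ (_ : k ≠ 0), weightSpace q a k :=
    (show (⨆ k, ⨆ (_ : k ≠ 0), W k) ≤ _ from iSup₂_mono fun _ _ => inf_le_right) hy
  rw [Submodule.disjoint_def.1 (hind 0) y hy0 hy1, add_zero]
  exact hx.1

/-! ### Invariance of the two half-lines -/

theorem parity_sub {k m : ℤ} (h : Even (k - m)) (hne : k ≠ m) : k ≤ m - 2 ∨ m + 2 ≤ k := by
  obtain ⟨r, hr⟩ := h
  omega

theorem even_shift {k m : ℤ} (h : Even (k - m)) : Even (k + 1 - (m + 1)) ∧ Even (k - 1 - (m + 1)) ∧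
    Even (k + 1 - (m - 1)) ∧ Even (k - 1 - (m - 1)) := by
  obtain ⟨r, hr⟩ := h
  exact ⟨⟨r, by omega⟩, ⟨r - 1, by omega⟩, ⟨r + 1, by omega⟩, ⟨r, by omega⟩⟩

/-- Elements of the Podleś sphere do not move functions that vanish at the nonpositive even
weights out of the space of such functions. -/
theorem act_eq_zero_of_nonpos {q : Param} {a : ℝ} {b : Oq q} (hb : b ∈ Podles q a) {f : ℤ →₀ ℂ}
    (hf : ∀ k ≤ 0, Even k → f k = 0) {n : ℤ} (hn : n ≤ 0) (he : Even n) : act q a b f n = 0 := by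
  -- The right factor of a product acts first, so appending a ladder step changes the condition on
  -- the input `f`. The threshold for `f` moves with the weight `m`, while that for the output stays
  -- at `0`.
  let V : ℤ → Submodule ℂ (Oq q) := fun m =>
    { carrier := {x | ∀ f : ℤ →₀ ℂ, (∀ k ≤ m, Even (k - m) → f k = 0) →
        ∀ n ≤ 0, Even n → act q a x f n = 0}
      zero_mem' := fun f _ n _ _ => by simp
      add_mem' := fun {x y} hx hy f hf n hn he => by simp [hx f hf n hn he, hy f hf n hn he]
      smul_mem' := fun c x hx f hf n hn he => by simp [hx f hf n hn he] }
  have key : b ∈ V 0 := by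
    refine mem_of_mem_Podles V ?_ ?_ ?_ hb
    · intro f hf n hn he
      simpa using hf n hn (by simpa using he)
    · intro m x s t hx f hf
      rw [map_mul]
      refine hx _ fun k hk hkm => ?_
      obtain ⟨e1, e2, -, -⟩ := even_shift hkm
      rw [act_stepEl, shiftOp_apply, hf (k + 1) (by omega) e1, hf (k - 1) (by omega) e2]
      simp
    · intro m x s t hx f hf
      rw [map_mul]
      refine hx _ fun k hk hkm => ?_
      obtain ⟨-, -, e3, e4⟩ := even_shift hkm
      rw [act_stepEl, shiftOp_apply, hf (k - 1) (by omega) e4]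
      -- At `k = m` the value `f (m + 1)` is unconstrained, but its coefficient contains `(wt q a
      -- m)⁻¹ + c = 0`. For `k < m`, parity gives `k + 1 ≤ m - 1`.
      rcases eq_or_ne k m with rfl | hne
      · simp
      · rw [hf (k + 1) (by rcases parity_sub hkm hne with h | h <;> omega) e3]
        simp
  exact key f (by simpa using hf) n hn he

/-- Mirror image of `act_eq_zero_of_nonpos`: the critical step is now the upward one, where the
coefficient of `f (m - 1)` at `m` contains `wt q a m - c = 0`. -/
theorem act_eq_zero_of_nonneg {q : Param} {a : ℝ} {b : Oq q} (hb : b ∈ Podles q a) {f : ℤ →₀ ℂ}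
    (hf : ∀ k, 0 ≤ k → Even k → f k = 0) {n : ℤ} (hn : 0 ≤ n) (he : Even n) :
    act q a b f n = 0 := by
  let V : ℤ → Submodule ℂ (Oq q) := fun m =>
    { carrier := {x | ∀ f : ℤ →₀ ℂ, (∀ k, m ≤ k → Even (k - m) → f k = 0) →
        ∀ n, 0 ≤ n → Even n → act q a x f n = 0}
      zero_mem' := fun f _ n _ _ => by simp
      add_mem' := fun {x y} hx hy f hf n hn he => by simp [hx f hf n hn he, hy f hf n hn he]
      smul_mem' := fun c x hx f hf n hn he => by simp [hx f hf n hn he] }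
  have key : b ∈ V 0 := by
    refine mem_of_mem_Podles V ?_ ?_ ?_ hb
    · intro f hf n hn he
      simpa using hf n hn (by simpa using he)
    · intro m x s t hx f hf
      rw [map_mul]
      refine hx _ fun k hk hkm => ?_
      obtain ⟨e1, e2, -, -⟩ := even_shift hkm
      rw [act_stepEl, shiftOp_apply, hf (k + 1) (by omega) e1]
      rcases eq_or_ne k m with rfl | hne
      · simp
      · rw [hf (k - 1) (by rcases parity_sub hkm hne with h | h <;> omega) e2]
        simp
    · intro m x s t hx f hf
      rw [map_mul]
      refine hx _ fun k hk hkm => ?_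
      obtain ⟨-, -, e3, e4⟩ := even_shift hkm
      rw [act_stepEl, shiftOp_apply, hf (k + 1) (by omega) e3, hf (k - 1) (by omega) e4]
      simp
  exact key f (by simpa using hf) n hn he

namespace D2

variable {q : Param} {a : ℝ}

theorem coord_restr (g : ℤ →₀ ℂ) (n : {n : ℤ // n ≠ 0}) : (restr q a g).coord n = g (2 * n) := rfl

theorem incl_two_mul (v : D2 q a) (n : {n : ℤ // n ≠ 0}) : incl q a v (2 * n) = v.coord n :=
  Finsupp.mapDomain_apply two_mul_inj v n

theorem rep_mem_plus (b : Podles q a) {v : D2 q a} (hv : v ∈ plus q a) :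
    rep q a b v ∈ plus q a := by
  intro n hn
  refine act_eq_zero_of_nonpos b.2 (fun k hk he => ?_) (by change 2 * (n : ℤ) ≤ 0; omega) (even_two_mul _)
  obtain ⟨r, rfl⟩ := even_iff_exists_two_mul.1 he
  rcases eq_or_ne r 0 with rfl | hr
  · exact incl_zero v
  · exact (incl_two_mul v ⟨r, hr⟩).trans (hv ⟨r, hr⟩ (by change r < 0; omega))

theorem rep_mem_minus (b : Podles q a) {v : D2 q a} (hv : v ∈ minus q a) :
    rep q a b v ∈ minus q a := by
  intro n hn
  refine act_eq_zero_of_nonneg b.2 (fun k hk he => ?_) (by change 0 ≤ 2 * (n : ℤ); omega) (even_two_mul _)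
  obtain ⟨r, rfl⟩ := even_iff_exists_two_mul.1 he
  rcases eq_or_ne r 0 with rfl | hr
  · exact incl_zero v
  · exact (incl_two_mul v ⟨r, hr⟩).trans (hv ⟨r, hr⟩ (by change 0 < r; omega))

end D2

/-! ### The involution -/

theorem smul_shiftOp (c : ℂ) (u d : ℤ → ℂ) :
    c • shiftOp u d = shiftOp (fun m => c * u m) (fun m => c * d m) := by
  refine LinearMap.ext fun f => Finsupp.ext fun n => ?_
  simp
  ring

/-- The operator of multiplication by a function of the weights. -/
def mulOp (c : ℤ → ℂ) : Module.End ℂ (ℤ →₀ ℂ) :=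
  Finsupp.linearCombination ℂ fun m => Finsupp.single m (c m)

@[simp] theorem mulOp_apply (c : ℤ → ℂ) (f : ℤ →₀ ℂ) (m : ℤ) : mulOp c f m = c m * f m := by
  induction f using Finsupp.induction_linear with
  | zero => simp
  | add f g hf hg => simp only [map_add, Finsupp.add_apply, hf, hg]; ring
  | single k c =>
    simp only [mulOp, Finsupp.linearCombination_single, Finsupp.smul_apply, Finsupp.single_apply,
      smul_eq_mul]
    split_ifs <;> subst_vars <;> ring

/-- The function of the weights that intertwines `x` and `k⁻¹ ▷ x` for `x` of weight `[a + m]`. -/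
def twist (q : Param) (a : ℝ) (m k : ℤ) : ℂ :=
  ((wt q a k)⁻¹ + wt q a m) * (wt q a k - wt q a m) / wt q a m

/-- Expanding the product shows that `twist q a m k` is `(q - q⁻¹) ([a + k] - [a + m])`. Its factors
are those of the ladder coefficients, and moving both indices by one step exchanges the factors for
`c` with those for `q² c`, as `k⁻¹ ▷` requires. -/
theorem act_stepEl_twist_up (q : Param) (a : ℝ) (m : ℤ) (s t : ℂ) :
    act q a (stepEl q (wt q a m) s t) * mulOp (twist q a (m + 1)) =
      mulOp (twist q a m) * act q a (Oq.kInvAct q (stepEl q (wt q a m) s t)) := by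
  refine LinearMap.ext fun f => Finsupp.ext fun n => ?_
  have hq := Oq.qc_ne q
  have hm := wt_ne q a m
  have hn := wt_ne q a n
  have hc := curC_ne q a n
  simp only [kInvAct_stepEl, map_smul, act_stepEl, Module.End.mul_apply, mulOp_apply,
    LinearMap.smul_apply, shiftOp_apply, twist, wt_add_one, wt_sub_one, Finsupp.smul_apply,
    smul_eq_mul]
  field_simp

theorem act_stepEl_twist_down (q : Param) (a : ℝ) (m : ℤ) (s t : ℂ) :
    act q a (stepEl q (-(wt q a m)⁻¹) s t) * mulOp (twist q a (m - 1)) =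
      mulOp (twist q a m) * act q a (Oq.kInvAct q (stepEl q (-(wt q a m)⁻¹) s t)) := by
  refine LinearMap.ext fun f => Finsupp.ext fun n => ?_
  have hq := Oq.qc_ne q
  have hm := wt_ne q a m
  have hn := wt_ne q a n
  have hc := curC_ne q a n
  simp only [kInvAct_stepEl, map_smul, act_stepEl, Module.End.mul_apply, mulOp_apply,
    LinearMap.smul_apply, shiftOp_apply, twist, wt_add_one, wt_sub_one, Finsupp.smul_apply,
    smul_eq_mul]
  field_simp
  ring

/-- Along a ladder path the one-step relations telescope from the final index `m` to `0`; on a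
closed path the same function stands on both sides. -/
theorem act_twist {q : Param} {a : ℝ} {b : Oq q} (hb : b ∈ Podles q a) :
    act q a b * mulOp (twist q a 0) = mulOp (twist q a 0) * act q a (Oq.kInvAct q b) := by
  let V : ℤ → Submodule ℂ (Oq q) := fun m =>
    { carrier := {x | act q a x * mulOp (twist q a m) =
        mulOp (twist q a 0) * act q a (Oq.kInvAct q x)}
      zero_mem' := by simp
      add_mem' := fun {x y} hx hy => by
        simp only [Set.mem_ofPred_eq] at *
        simp only [map_add, add_mul, mul_add, hx, hy]
      smul_mem' := fun c x hx => by
        simp only [Set.mem_ofPred_eq] at *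
        simp only [map_smul, smul_mul_assoc, mul_smul_comm, hx] }
  refine mem_of_mem_Podles V (by simp [V]) ?_ ?_ hb
  · intro m x s t (hx : _ = _)
    change _ = _
    rw [map_mul, mul_assoc, act_stepEl_twist_up, ← mul_assoc, hx, map_mul, map_mul, mul_assoc]
  · intro m x s t (hx : _ = _)
    change _ = _
    rw [map_mul, mul_assoc, act_stepEl_twist_down, ← mul_assoc, hx, map_mul, map_mul, mul_assoc]

/-! ### The form with weights `{a + m}` and adjoints of `O_q(SU(2))` -/

/-- The sesquilinear form with weights `{a + m}`. -/
def curForm (q : Param) (a : ℝ) (f g : ℤ →₀ ℂ) : ℂ :=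
  f.sum fun n c => conj c * curC q a n * g n

section curForm

variable (q : Param) (a : ℝ)

theorem curForm_add_left (f f' g : ℤ →₀ ℂ) :
    curForm q a (f + f') g = curForm q a f g + curForm q a f' g :=
  Finsupp.sum_add_index' (by simp) (by intro n x y; simp; ring)

theorem curForm_add_right (f g g' : ℤ →₀ ℂ) :
    curForm q a f (g + g') = curForm q a f g + curForm q a f g' := by
  simp [curForm, mul_add, Finsupp.sum_add]

theorem curForm_single_left (n : ℤ) (c : ℂ) (g : ℤ →₀ ℂ) :
    curForm q a (Finsupp.single n c) g = conj c * curC q a n * g n :=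
  Finsupp.sum_single_index (by simp)

theorem curForm_zero_left (g : ℤ →₀ ℂ) : curForm q a 0 g = 0 := Finsupp.sum_zero_index

theorem curForm_smul_left (c : ℂ) (f g : ℤ →₀ ℂ) :
    curForm q a (c • f) g = conj c * curForm q a f g := by
  rw [curForm, Finsupp.sum_smul_index' (by simp), curForm, Finsupp.mul_sum]
  refine Finsupp.sum_congr fun n _ => ?_
  simp
  ring

theorem curForm_smul_right (c : ℂ) (f g : ℤ →₀ ℂ) :
    curForm q a f (c • g) = c * curForm q a f g := by
  rw [curForm, curForm, Finsupp.mul_sum]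
  refine Finsupp.sum_congr fun n _ => ?_
  simp
  ring

/-- The two hypotheses compare the matrix entries on the two off-diagonals. -/
theorem curForm_shiftOp (u d u' d' : ℤ → ℂ)
    (h1 : ∀ m, conj (u m) * curC q a m = curC q a (m + 1) * d' (m + 1))
    (h2 : ∀ m, conj (d (m + 1)) * curC q a (m + 1) = curC q a m * u' m) (f g : ℤ →₀ ℂ) :
    curForm q a (shiftOp u d f) g = curForm q a f (shiftOp u' d' g) := by
  induction f using Finsupp.induction_linear with
  | zero => simp [curForm_zero_left]
  | add f f' hf hf' => rw [map_add, curForm_add_left, curForm_add_left, hf, hf']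
  | single k c =>
    have h3 := h1 (k - 1)
    rw [sub_add_cancel] at h3
    rw [shiftOp, Finsupp.linearCombination_single, curForm_smul_left, curForm_add_left,
      curForm_single_left, curForm_single_left, curForm_single_left, shiftOp_apply]
    linear_combination conj c * g (k - 1) * h3 + conj c * g (k + 1) * h2 k

end curForm

theorem conj_wt (q : Param) (a : ℝ) (m : ℤ) : conj (wt q a m) = wt q a m := by simp [wt]

theorem conj_curC (q : Param) (a : ℝ) (m : ℤ) : conj (curC q a m) = curC q a m := by
  simp [curC, conj_wt]

/-- Adjoints and `star` both reverse products and `k⁻¹ ▷` is multiplicative, so the generators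
decide. The form itself is not invariant under `*`; the defect `k⁻¹` is what `act_twist` removes on
the sphere. -/
theorem curForm_act_star (q : Param) (a : ℝ) (x : Oq q) : ∀ f g : ℤ →₀ ℂ,
    curForm q a (act q a (star x) f) g = curForm q a f (act q a (Oq.kInvAct q x) g) := by
  induction x using Oq.induction with
  | hc c =>
    intro f g
    simp [Oq.star_algebraMap', Module.algebraMap_end_apply, curForm_smul_left, curForm_smul_right]
  | hg g =>
    have hq := Oq.qc_ne q
    have hc := Oq.conj_qc q
    rw [Oq.star_gen]
    intro f h
    cases g <;>
    · simp only [Gen.inv, act, Oq.kInvAct, Oq.lift_gen, map_smul, LinearMap.smul_apply,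
        curForm_smul_right, genAct]
      rw [← curForm_smul_right, ← LinearMap.smul_apply, smul_shiftOp]
      refine curForm_shiftOp q a _ _ _ _ (fun m => ?_) (fun m => ?_) f h
      all_goals
        have h0 := curC_ne q a m
        have h1 := curC_ne q a (m + 1)
        have hw := wt_ne q a m
        have hI := Complex.conj_I
        simp only [map_div₀, map_mul, map_inv₀, map_neg, hc, hI, conj_wt, conj_curC]
        field_simp
        try simp only [wt_add_one]
        try field_simp
        try ring
  | ha x y hx hy =>
    intro f g
    simp only [star_add, map_add, LinearMap.add_apply, curForm_add_left, curForm_add_right, hx, hy]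
  | hm x y hx hy =>
    intro f g
    simp only [star_mul, map_mul, Module.End.mul_apply, hx, hy]

/-! ### Comparison of the norms with the twisted form -/

theorem wt_add (q : Param) (a : ℝ) (m n : ℤ) : wt q a (m + n) = wt q a m * qc q ^ n := by
  have h0 := q.2.1
  simp only [wt, qc, ← Complex.ofReal_zpow, ← Complex.ofReal_mul]
  congr 1
  rw [← Real.rpow_intCast, ← Real.rpow_add h0]
  push_cast
  ring_nf

theorem wt_injective (q : Param) (a : ℝ) : Function.Injective (wt q a) := by
  intro m n h
  have h2 := Complex.ofReal_injective h
  have h3 := (Real.strictAnti_rpow_of_base_lt_one q.2.1 q.2.2).injective h2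
  exact_mod_cast add_left_cancel h3

theorem wt_add_inv_ne (q : Param) (a : ℝ) (m n : ℤ) : wt q a m + (wt q a n)⁻¹ ≠ 0 := by
  have h1 : 0 < (q : ℝ) ^ (a + m) := Real.rpow_pos_of_pos q.2.1 _
  have h2 : 0 < (q : ℝ) ^ (a + n) := Real.rpow_pos_of_pos q.2.1 _
  have : 0 < (q : ℝ) ^ (a + m) + ((q : ℝ) ^ (a + n))⁻¹ := by positivity
  simp only [wt]
  exact_mod_cast this.ne'

theorem twist_ne {q : Param} {a : ℝ} {m k : ℤ} (h : k ≠ m) : twist q a m k ≠ 0 := by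
  have h1 := wt_add_inv_ne q a m k
  rw [add_comm] at h1
  exact div_ne_zero (mul_ne_zero h1 (sub_ne_zero.2 fun h2 => h (wt_injective q a h2)))
    (wt_ne q a m)

theorem cur_eq_curC (q : Param) (a : ℝ) (m : ℤ) : (cur q (a + m) : ℂ) = curC q a m := by
  rw [cur, Real.rpow_neg q.2.1.le]
  simp [curC, wt]

/-- The squared norms are, up to a constant and a sign, the quotients of `{a + 2 n}` by the
twisting function. -/
theorem exists_normSq_mul_twist (q : Param) (a : ℝ) : ∃ K : ℂ, ∀ n : {n : ℤ // n ≠ 0},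
    (D2.normSq q a n : ℂ) * twist q a 0 (2 * n) = -((n : ℤ).sign : ℂ) * K * curC q a (2 * n) := by
  -- `K` collects the factors of the squared norm that do not depend on `n`.
  refine ⟨(cur q (a + 2) / (cur q a * (cur q (2 * a + 1) + q + (q : ℝ)⁻¹)) : ℝ) /
    ((qc q)⁻¹ - qc q), fun n => ?_⟩
  have h0 := q.2.1
  have h1 := q.2.2
  have hq := Oq.qc_ne q
  have hd : (qc q)⁻¹ - qc q ≠ 0 := fun h => qdiff_ne q (by linear_combination -h)
  have habs : ((|(q : ℝ) ^ (-(n : ℤ)) - (q : ℝ) ^ (n : ℤ)| : ℝ) : ℂ) =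
      ((n : ℤ).sign : ℂ) * ((qc q) ^ (-(n : ℤ)) - (qc q) ^ (n : ℤ)) := by
    rcases lt_or_gt_of_ne n.2 with h | h
    · rw [abs_of_nonpos, Int.sign_eq_neg_one_of_neg h]
      · simp [qc]
      · have := zpow_right_strictAnti₀ h0 h1 (show (n : ℤ) < -(n : ℤ) by omega)
        linarith
    · rw [abs_of_nonneg, Int.sign_eq_one_of_pos h]
      · simp [qc]
      · have := zpow_right_strictAnti₀ h0 h1 (show -(n : ℤ) < (n : ℤ) by omega)
        linarith
  have hs : ((n : ℤ).sign : ℂ) * ((n : ℤ).sign : ℂ) = 1 := by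
    rcases lt_or_gt_of_ne n.2 with h | h
    · simp [Int.sign_eq_neg_one_of_neg h]
    · simp [Int.sign_eq_one_of_pos h]
  have hs0 : ((n : ℤ).sign : ℂ) ≠ 0 := left_ne_zero_of_mul_eq_one hs
  have hx := zpow_ne_zero (n : ℤ) hq
  have hxd : (qc q ^ (n : ℤ))⁻¹ - qc q ^ (n : ℤ) ≠ 0 := by
    rw [← zpow_neg]
    intro h
    have h2 : wt q a (0 + -(n : ℤ)) = wt q a (0 + (n : ℤ)) := by
      rw [wt_add, wt_add, sub_eq_zero.1 h]
    have := wt_injective q a h2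
    have := n.2
    omega
  have hc : curC q a n ≠ 0 := curC_ne q a n
  have hE := wt_ne q a 0
  have e1 : (cur q (a + 2 * ((n : ℤ) : ℝ)) : ℂ) = curC q a (2 * n) := by
    rw [← cur_eq_curC]
    push_cast
    rfl
  have e2 : wt q a (2 * n) = wt q a 0 * (qc q ^ (n : ℤ)) ^ 2 := by
    rw [← zero_add (2 * (n : ℤ)), wt_add, mul_comm 2, zpow_mul]
    rfl
  have e3 : curC q a n = wt q a 0 * qc q ^ (n : ℤ) + (wt q a 0 * qc q ^ (n : ℤ))⁻¹ := by
    rw [curC, ← zero_add (n : ℤ), wt_add, zero_add]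
  -- The difference `[a + 2n] - [a]` factors through the midpoint `a + n`; this produces `q^(-n) -
  -- q^n` and `{a + n}` in the denominator of the norm.
  have key : twist q a 0 (2 * n) =
      -(((qc q ^ (n : ℤ))⁻¹ - qc q ^ (n : ℤ)) * curC q a n) := by
    rw [twist, e2, e3]
    field_simp
    ring
  rw [key, D2.normSq, Complex.ofReal_mul, Complex.ofReal_div (cur q (a + 2 * ((n : ℤ) : ℝ))),
    Complex.ofReal_mul, Complex.ofReal_mul, e1, habs, cur_eq_curC, zpow_neg, Complex.ofReal_sub,
    Complex.ofReal_inv]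
  change _ * (_ / (((qc q)⁻¹ - qc q) * _ * _)) * _ = _
  generalize (n : ℤ).sign = σ at *
  generalize curC q a n = c1 at *
  generalize curC q a (2 * n) = c2 at *
  generalize (qc q ^ (n : ℤ))⁻¹ - qc q ^ (n : ℤ) = dx at *
  generalize (qc q)⁻¹ - qc q = dq at *
  generalize ((cur q (a + 2) / (cur q a * (cur q (2 * a + 1) + q + (q : ℝ)⁻¹)) : ℝ) : ℂ) = X
  field_simp
  linear_combination X * c2 * hs

/-- The matrix entry of `k⁻¹ ▷ b` at `(n, k)` is computed once from `act_twist` and once from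
`curForm_act_star`, then eliminated. No division by `twist` occurs, so the identity also holds at
weight `[a]`. -/
theorem act_single_star {q : Param} {a : ℝ} {b : Oq q} (hb : b ∈ Podles q a) (n k : ℤ) :
    act q a b (Finsupp.single k 1) n * twist q a 0 k * curC q a n =
      twist q a 0 n * conj (act q a (star b) (Finsupp.single n 1) k) * curC q a k := by
  have h1 := curForm_act_star q a b (Finsupp.single n 1) (Finsupp.single k 1)
  have h2 : conj (act q a (star b) (Finsupp.single n 1) k) * curC q a k =
      curForm q a (act q a (star b) (Finsupp.single n 1)) (Finsupp.single k 1) := by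
    generalize act q a (star b) (Finsupp.single n 1) = f
    induction f using Finsupp.induction_linear with
    | zero => simp [curForm_zero_left]
    | add f g hf hg => rw [curForm_add_left, ← hf, ← hg, Finsupp.add_apply, map_add]; ring
    | single j c =>
      rw [curForm_single_left, Finsupp.single_apply, Finsupp.single_apply]
      by_cases h : j = k
      · simp [h]
      · simp [h, Ne.symm h]
  have h3 := congrArg (fun T : Module.End ℂ (ℤ →₀ ℂ) => T (Finsupp.single k 1) n) (act_twist hb)
  have h4 : mulOp (twist q a 0) (Finsupp.single k 1) = twist q a 0 k • Finsupp.single k 1 := by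
    simp [mulOp]
  simp only [Module.End.mul_apply, mulOp_apply, h4, map_smul, Finsupp.smul_apply, smul_eq_mul] at h3
  rw [curForm_single_left, ← h2, map_one, one_mul] at h1
  linear_combination curC q a n * h3 - twist q a 0 n * h1

/-! ### Basis vectors, matrix coefficients and the *-property -/

namespace D2

variable {q : Param} {a : ℝ}

/-- The vector `e n`, which is zero for `n = 0`. -/
def e (q : Param) (a : ℝ) (n : ℤ) : D2 q a := restr q a (Finsupp.single (2 * n) 1)

theorem e_zero : e q a 0 = 0 := by
  refine Finsupp.ext (f := (e q a 0).coord) (g := 0) fun n => ?_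
  rw [e, coord_restr, Finsupp.single_apply, if_neg]
  · rfl
  · have := n.2
    omega

theorem incl_e {n : ℤ} (h : n ≠ 0) : incl q a (e q a n) = Finsupp.single (2 * n) 1 := by
  refine incl_restr _ ?_ fun k hk => ?_
  · rw [Finsupp.single_apply, if_neg (by omega)]
  · obtain ⟨r, rfl⟩ := hk
    rw [Finsupp.single_apply, if_neg (by omega)]

theorem e_eq_single {n : ℤ} (h : n ≠ 0) :
    e q a n = (Finsupp.single ⟨n, h⟩ 1 : {n : ℤ // n ≠ 0} →₀ ℂ) := by
  have h1 : incl q a (Finsupp.single ⟨n, h⟩ 1 : {n : ℤ // n ≠ 0} →₀ ℂ) =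
      Finsupp.single (2 * n) 1 := Finsupp.mapDomain_single
  rw [e, ← h1]
  exact restr_incl (Finsupp.single ⟨n, h⟩ 1 : {n : ℤ // n ≠ 0} →₀ ℂ)

theorem induction_linear {P : D2 q a → Prop} (h0 : P 0) (hadd : ∀ v w, P v → P w → P (v + w))
    (he : ∀ n (_ : n ≠ 0) (c : ℂ), P (c • e q a n)) (v : D2 q a) : P v := by
  refine Finsupp.induction_linear (motive := P) v h0 hadd fun n c => ?_
  have := he n n.2 c
  rw [e_eq_single n.2] at this
  have h2 : (c • (Finsupp.single n 1 : {n : ℤ // n ≠ 0} →₀ ℂ)) = Finsupp.single n c := by simp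
  rw [← h2]
  exact this

theorem inner_e_left {n : ℤ} (h : n ≠ 0) (w : D2 q a) :
    ⟪e q a n, w⟫_ℂ = normSq q a ⟨n, h⟩ * w.coord ⟨n, h⟩ := by
  rw [e_eq_single h]
  change Finsupp.sum (Finsupp.single _ _) _ = _
  rw [Finsupp.sum_single_index (by simp)]
  simp

theorem rep_e (b : Podles q a) {n : ℤ} (h : n ≠ 0) :
    rep q a b (e q a n) = restr q a (act q a b (Finsupp.single (2 * n) 1)) := by
  rw [← incl_e h]
  rfl

theorem e_mem_plus {n : ℤ} (h : 0 < n) : e q a n ∈ plus q a := by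
  intro k hk
  rw [e, coord_restr, Finsupp.single_apply, if_neg (by omega)]

theorem e_mem_minus {n : ℤ} (h : n < 0) : e q a n ∈ minus q a := by
  intro k hk
  rw [e, coord_restr, Finsupp.single_apply, if_neg (by omega)]

/-- The matrix coefficients of the representation between the two summands vanish. -/
theorem coord_rep_eq_zero (b : Podles q a) {n : ℤ} (hn : n ≠ 0) (k : {n : ℤ // n ≠ 0})
    (h : (k : ℤ).sign ≠ n.sign) : (rep q a b (e q a n)).coord k = 0 := by
  rcases lt_or_gt_of_ne hn with h1 | h1
  · refine rep_mem_minus b (e_mem_minus h1) k ?_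
    by_contra h2
    have h3 : (k : ℤ) < 0 := by have := k.2; omega
    exact h (by rw [Int.sign_eq_neg_one_of_neg h3, Int.sign_eq_neg_one_of_neg h1])
  · refine rep_mem_plus b (e_mem_plus h1) k ?_
    by_contra h2
    have h3 : 0 < (k : ℤ) := by have := k.2; omega
    exact h (by rw [Int.sign_eq_one_of_pos h3, Int.sign_eq_one_of_pos h1])

end D2

theorem isStarRep_rep (q : Param) (a : ℝ) : IsStarRep (rep q a) := by
  intro b v w
  induction v using D2.induction_linear with
  | h0 => simp
  | hadd v v' hv hv' => simp only [map_add, inner_add_left, hv, hv']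
  | he n hn c =>
    rw [map_smul, inner_smul_left, inner_smul_left]
    congr 1
    induction w using D2.induction_linear with
    | h0 => simp
    | hadd w w' hw hw' => simp only [map_add, inner_add_right, hw, hw']
    | he k hk c =>
      rw [map_smul, inner_smul_right, inner_smul_right]
      congr 1
      rw [← inner_conj_symm, D2.inner_e_left hk, D2.inner_e_left hn]
      -- On one half-line the signs in `exists_normSq_mul_twist` agree and `act_single_star`
      -- applies; between the half-lines both matrix coefficients vanish, so the differing signs do
      -- not matter.
      by_cases hs : k.sign = n.sign
      · obtain ⟨K, hK⟩ := exists_normSq_mul_twist q a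
        have hKn := hK ⟨n, hn⟩
        have hKk := hK ⟨k, hk⟩
        have h := act_single_star b.2 (2 * n) (2 * k)
        rw [D2.rep_e _ hn, D2.rep_e _ hk, D2.coord_restr, D2.coord_restr, map_mul,
          Complex.conj_ofReal]
        have t1 : twist q a 0 (2 * n) ≠ 0 := twist_ne (by omega)
        have t2 : twist q a 0 (2 * k) ≠ 0 := twist_ne (by omega)
        -- Multiplying by both twists replaces each squared norm by a multiple of `curC`.
        refine mul_right_cancel₀ (mul_ne_zero t1 t2) ?_
        simp only at hKn hKk ⊢
        rw [hs] at hKk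
        change _ * conj (act q a (star (b : Oq q)) _ _) * _ = _
        linear_combination twist q a 0 (2 * n) *
          conj (act q a (star (b : Oq q)) (Finsupp.single (2 * n) 1) (2 * k)) * hKk
          - twist q a 0 (2 * k) * act q a b (Finsupp.single (2 * k) 1) (2 * n) * hKn
          + (n.sign : ℂ) * K * h
      · rw [D2.coord_rep_eq_zero _ hn _ hs, D2.coord_rep_eq_zero _ hk _ (Ne.symm hs)]
        simp

/-- After `incl`, which is injective because `restr` is a left inverse, the cocycle is the
coboundary `b ▷ e_a - ε(b) e_a` and the identity is formal. -/
theorem isOneCocycle_cocycle (q : Param) (a : ℝ) :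
    IsOneCocycle (rep q a) (eps q a) (cocycle q a) := by
  intro b c
  have h1 : D2.incl q a (cocycle q a (b * c)) =
      D2.incl q a (rep q a b (cocycle q a c) + eps q a c • cocycle q a b) := by
    have h2 : D2.incl q a (rep q a b (cocycle q a c)) =
        act q a b (D2.incl q a (cocycle q a c)) := D2.incl_restr_act b _
    rw [map_add, map_smul, h2, incl_cocycle, incl_cocycle, incl_cocycle]
    change act q a ((b : Oq q) * c) _ - Oq.counit q ((b : Oq q) * c) • _ = _ + Oq.counit q c • _
    simp only [map_mul, Module.End.mul_apply, map_sub, map_smul, smul_sub, smul_smul]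
    rw [mul_comm (Oq.counit q b)]
    abel
  have h3 := congrArg (D2.restr q a) h1
  rwa [D2.restr_incl, D2.restr_incl] at h3

/-! ### Elements of length two -/

/-- The coefficients of `f (n + 1)` in the action of `stepEl`. -/
def stepUp (q : Param) (a : ℝ) (c s t : ℂ) (n : ℤ) : ℂ :=
  (s + t * Complex.I * wt q a n) * ((wt q a n)⁻¹ + c) / curC q a n

/-- The coefficients of `f (n - 1)` in the action of `stepEl`. -/
def stepDown (q : Param) (a : ℝ) (c s t : ℂ) (n : ℤ) : ℂ :=
  (s - t * Complex.I * (wt q a n)⁻¹) * (wt q a n - c) / curC q a n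

theorem act_stepEl_single (q : Param) (a : ℝ) (c s t : ℂ) (m : ℤ) :
    act q a (stepEl q c s t) (Finsupp.single m 1) =
      stepUp q a c s t (m - 1) • Finsupp.single (m - 1) 1 +
        stepDown q a c s t (m + 1) • Finsupp.single (m + 1) 1 := by
  rw [act_stepEl, shiftOp, Finsupp.linearCombination_single, one_smul, Finsupp.smul_single_one,
    Finsupp.smul_single_one]
  rfl

/-- Two steps give a tridiagonal operator on the even weights. With the convention `D2.e q a 0 = 0`,
the formula remains uniform when an index is zero. -/
theorem restr_act_stepEl_mul (q : Param) (a : ℝ) (c s t c' s' t' : ℂ) (n : ℤ) :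
    D2.restr q a (act q a (stepEl q c s t * stepEl q c' s' t') (Finsupp.single (2 * n) 1)) =
      (stepUp q a c' s' t' (2 * n - 1) * stepUp q a c s t (2 * n - 2)) • D2.e q a (n - 1) +
      (stepUp q a c' s' t' (2 * n - 1) * stepDown q a c s t (2 * n) +
        stepDown q a c' s' t' (2 * n + 1) * stepUp q a c s t (2 * n)) • D2.e q a n +
      (stepDown q a c' s' t' (2 * n + 1) * stepDown q a c s t (2 * n + 2)) • D2.e q a (n + 1) := by
  have e1 : 2 * n - 1 - 1 = 2 * n - 2 := by ring
  have e2 : 2 * n + 1 + 1 = 2 * n + 2 := by ring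
  have e3 : 2 * (n - 1) = 2 * n - 2 := by ring
  have e4 : 2 * (n + 1) = 2 * n + 2 := by ring
  rw [map_mul, Module.End.mul_apply, act_stepEl_single]
  simp only [map_add, map_smul, act_stepEl_single, sub_add_cancel, add_sub_cancel_right, e1, e2,
    D2.e, e3, e4]
  module

/-- The product of ladder elements along the path `[a], [a + 1], [a]`. -/
def upDown (q : Param) (a : ℝ) (c : ℂ) : Podles q a :=
  ⟨stepEl q (wt q a 0) (-c) 1 * stepEl q (-(wt q a 1)⁻¹) 1 0, by
    have h := mul_stepEl_up (one_mem_weightSpace q a) (-c) 1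
    rw [one_mul] at h
    exact mem_weightSpace_zero_iff.1 (mul_stepEl_down h 1 0)⟩

/-- The product of ladder elements along the path `[a], [a - 1], [a]`. -/
def downUp (q : Param) (a : ℝ) (c : ℂ) : Podles q a :=
  ⟨stepEl q (-(wt q a 0)⁻¹) (-c) 1 * stepEl q (wt q a (-1)) 1 0, by
    have h := mul_stepEl_down (one_mem_weightSpace q a) (-c) 1
    rw [one_mul] at h
    exact mem_weightSpace_zero_iff.1 (mul_stepEl_up h 1 0)⟩

theorem eps_upDown (q : Param) (a : ℝ) (c : ℂ) :
    eps q a (upDown q a c) = -c + Complex.I * wt q a 0 := by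
  change Oq.counit q (stepEl q (wt q a 0) (-c) 1 * stepEl q (-(wt q a 1)⁻¹) 1 0) = _
  rw [map_mul, counit_stepEl, counit_stepEl]
  ring

theorem eps_downUp (q : Param) (a : ℝ) (c : ℂ) :
    eps q a (downUp q a c) = -c - Complex.I * (wt q a 0)⁻¹ := by
  change Oq.counit q (stepEl q (-(wt q a 0)⁻¹) (-c) 1 * stepEl q (wt q a (-1)) 1 0) = _
  rw [map_mul, counit_stepEl, counit_stepEl]
  ring

section coefficients

variable (q : Param) (a : ℝ)

theorem stepUp_ne {m n : ℤ} {s t : ℂ} (h : s + t * Complex.I * wt q a n ≠ 0) :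
    stepUp q a (wt q a m) s t n ≠ 0 := by
  have := wt_add_inv_ne q a m n
  rw [add_comm] at this
  exact div_ne_zero (mul_ne_zero h this) (curC_ne q a n)

theorem stepDown_ne {m n : ℤ} {s t : ℂ} (h : s - t * Complex.I * (wt q a n)⁻¹ ≠ 0) (hn : n ≠ m) :
    stepDown q a (wt q a m) s t n ≠ 0 :=
  div_ne_zero (mul_ne_zero h (sub_ne_zero.2 fun h2 => hn (wt_injective q a h2))) (curC_ne q a n)

theorem stepUp_neg_inv_ne {m n : ℤ} (hn : n ≠ m) : stepUp q a (-(wt q a m)⁻¹) 1 0 n ≠ 0 := by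
  refine div_ne_zero (mul_ne_zero (by simp) ?_) (curC_ne q a n)
  rw [← sub_eq_add_neg, sub_ne_zero]
  exact fun h => hn (wt_injective q a (inv_injective h))

theorem stepDown_neg_inv_ne {m n : ℤ} : stepDown q a (-(wt q a m)⁻¹) 1 0 n ≠ 0 := by
  refine div_ne_zero (mul_ne_zero (by simp) ?_) (curC_ne q a n)
  rw [sub_neg_eq_add]
  exact wt_add_inv_ne q a n m

end coefficients

/-- Only the neighbours of `[a]` remain. The parameter `c` enters each coefficient linearly, so
either one can be removed by a choice of `c`. -/
theorem cocycle_upDown (q : Param) (a : ℝ) (c : ℂ) : cocycle q a (upDown q a c) =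
    (stepUp q a (-(wt q a 1)⁻¹) 1 0 (-1) * stepUp q a (wt q a 0) (-c) 1 (-2)) • D2.e q a (-1) +
    (stepDown q a (-(wt q a 1)⁻¹) 1 0 1 * stepDown q a (wt q a 0) (-c) 1 2) • D2.e q a 1 := by
  have h := restr_act_stepEl_mul q a (wt q a 0) (-c) 1 (-(wt q a 1)⁻¹) 1 0 0
  have h0 : D2.restr q a (Finsupp.single 0 1) = 0 := D2.e_zero
  rw [D2.e_zero, smul_zero, add_zero] at h
  change D2.restr q a (act q a (_ * _) _ - _) = _
  rw [map_sub, map_smul, h0, smul_zero, sub_zero]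
  exact h

theorem rep_upDown (q : Param) (a : ℝ) (c : ℂ) {n : ℤ} (hn : n ≠ 0) :
    rep q a (upDown q a c) (D2.e q a n) =
      (stepUp q a (-(wt q a 1)⁻¹) 1 0 (2 * n - 1) * stepUp q a (wt q a 0) (-c) 1 (2 * n - 2)) •
        D2.e q a (n - 1) +
      (stepUp q a (-(wt q a 1)⁻¹) 1 0 (2 * n - 1) * stepDown q a (wt q a 0) (-c) 1 (2 * n) +
        stepDown q a (-(wt q a 1)⁻¹) 1 0 (2 * n + 1) * stepUp q a (wt q a 0) (-c) 1 (2 * n)) •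
        D2.e q a n +
      (stepDown q a (-(wt q a 1)⁻¹) 1 0 (2 * n + 1) * stepDown q a (wt q a 0) (-c) 1 (2 * n + 2)) •
        D2.e q a (n + 1) := by
  rw [D2.rep_e _ hn]
  exact restr_act_stepEl_mul ..

theorem rep_downUp (q : Param) (a : ℝ) (c : ℂ) {n : ℤ} (hn : n ≠ 0) :
    rep q a (downUp q a c) (D2.e q a n) =
      (stepUp q a (wt q a (-1)) 1 0 (2 * n - 1) * stepUp q a (-(wt q a 0)⁻¹) (-c) 1 (2 * n - 2)) •
        D2.e q a (n - 1) +
      (stepUp q a (wt q a (-1)) 1 0 (2 * n - 1) * stepDown q a (-(wt q a 0)⁻¹) (-c) 1 (2 * n) +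
        stepDown q a (wt q a (-1)) 1 0 (2 * n + 1) * stepUp q a (-(wt q a 0)⁻¹) (-c) 1 (2 * n)) •
        D2.e q a n +
      (stepDown q a (wt q a (-1)) 1 0 (2 * n + 1) *
        stepDown q a (-(wt q a 0)⁻¹) (-c) 1 (2 * n + 2)) • D2.e q a (n + 1) := by
  rw [D2.rep_e _ hn]
  exact restr_act_stepEl_mul ..

/-! ### Generation and surjectivity of the cocycle -/

/-- The vectors `e 1` and `e (-1)` generate the representation. -/
theorem D2.eq_top_of_mem {q : Param} {a : ℝ} (W : Submodule ℂ (D2 q a))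
    (hW : ∀ b, ∀ v ∈ W, rep q a b v ∈ W) (h1 : D2.e q a 1 ∈ W) (h2 : D2.e q a (-1) ∈ W) :
    W = ⊤ := by
  have hpos : ∀ n : ℕ, D2.e q a n ∈ W ∧ D2.e q a (n + 1) ∈ W := by
    intro n
    induction n with
    | zero => exact ⟨by simp [D2.e_zero], by simpa using h1⟩
    | succ n ih =>
      obtain ⟨ih1, ih2⟩ := ih
      push_cast
      refine ⟨ih2, ?_⟩
      -- With parameter `0` the factor in `s, t` is a nonzero multiple of `wt` or its inverse, so
      -- the outermost coefficient never vanishes on this half-line and the next basis vector can be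
      -- solved for.
      have h := hW (upDown q a 0) _ ih2
      rw [rep_upDown _ _ _ (by omega), add_sub_cancel_right] at h
      refine (Submodule.smul_mem_iff _ ?_).1 ((Submodule.add_mem_iff_right _
        (add_mem (Submodule.smul_mem _ _ ih1) (Submodule.smul_mem _ _ ih2))).1 h)
      exact mul_ne_zero (stepDown_neg_inv_ne q a)
        (stepDown_ne q a (by simp [wt_ne]) (by omega))
  have hneg : ∀ n : ℕ, D2.e q a (-n) ∈ W ∧ D2.e q a (-n - 1) ∈ W := by
    intro n
    induction n with
    | zero => exact ⟨by simp [D2.e_zero], by simpa using h2⟩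
    | succ n ih =>
      obtain ⟨ih1, ih2⟩ := ih
      have e1 : -((n + 1 : ℕ) : ℤ) = -n - 1 := by push_cast; ring
      rw [e1]
      refine ⟨ih2, ?_⟩
      have h := hW (upDown q a 0) _ ih2
      rw [rep_upDown _ _ _ (by omega), sub_add_cancel, add_assoc] at h
      refine (Submodule.smul_mem_iff _ ?_).1 ((Submodule.add_mem_iff_left _
        (add_mem (Submodule.smul_mem _ _ ih2) (Submodule.smul_mem _ _ ih1))).1 h)
      exact mul_ne_zero (stepUp_neg_inv_ne q a (by omega))
        (stepUp_ne q a (by simp [wt_ne]))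
  rw [eq_top_iff]
  intro v _
  induction v using D2.induction_linear with
  | h0 => exact zero_mem _
  | hadd v w hv hw => exact add_mem (hv trivial) (hw trivial)
  | he n hn c =>
    refine Submodule.smul_mem _ _ ?_
    obtain ⟨k, rfl | rfl⟩ := n.eq_nat_or_neg
    · exact (hpos k).1
    · exact (hneg k).1

theorem cocycle_surjective (q : Param) (a : ℝ) : Function.Surjective (cocycle q a) := by
  have hI := Complex.I_ne_zero
  rw [← LinearMap.range_eq_top]
  refine D2.eq_top_of_mem _ ?_ ?_ ?_
  · rintro b _ ⟨c, rfl⟩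
    -- The cocycle identity solved for `π(b) C(c)`: the range is invariant.
    refine ⟨b * c - eps q a c • b, ?_⟩
    rw [map_sub, map_smul, isOneCocycle_cocycle]
    abel
  -- The parameter is the root of the coefficient of `e (-1)`, so only `e 1` survives; the next
  -- bullet uses the root of the coefficient of `e 1`.
  · have h : cocycle q a (upDown q a (Complex.I * wt q a (-2))) ∈ LinearMap.range (cocycle q a) :=
      ⟨_, rfl⟩
    have h0 : stepUp q a (wt q a 0) (-(Complex.I * wt q a (-2))) 1 (-2) = 0 := by
      simp [stepUp]
    rw [cocycle_upDown, h0, mul_zero, zero_smul, zero_add] at h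
    refine (Submodule.smul_mem_iff _ ?_).1 h
    refine mul_ne_zero (stepDown_neg_inv_ne q a) (stepDown_ne q a ?_ (by decide))
    rw [show -(Complex.I * wt q a (-2)) - 1 * Complex.I * (wt q a 2)⁻¹ =
      -Complex.I * (wt q a (-2) + (wt q a 2)⁻¹) by ring]
    exact mul_ne_zero (neg_ne_zero.2 hI) (wt_add_inv_ne q a _ _)
  · have h : cocycle q a (upDown q a (-(Complex.I * (wt q a 2)⁻¹))) ∈
      LinearMap.range (cocycle q a) := ⟨_, rfl⟩
    have h0 : stepDown q a (wt q a 0) (-(-(Complex.I * (wt q a 2)⁻¹))) 1 2 = 0 := by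
      simp [stepDown]
    rw [cocycle_upDown, h0, mul_zero, zero_smul, add_zero] at h
    refine (Submodule.smul_mem_iff _ ?_).1 h
    refine mul_ne_zero (stepUp_neg_inv_ne q a (by decide)) (stepUp_ne q a ?_)
    rw [show -(-(Complex.I * (wt q a 2)⁻¹)) + 1 * Complex.I * wt q a (-2) =
      Complex.I * (wt q a (-2) + (wt q a 2)⁻¹) by ring]
    exact mul_ne_zero hI (wt_add_inv_ne q a _ _)

/-! ### Absence of a Gaussian part -/

theorem qc_sq_ne_one (q : Param) : qc q ^ 2 - 1 ≠ 0 := fun h =>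
  qdiff_ne q (by have := Oq.qc_ne q; field_simp; linear_combination h)

/-- The parameter kills the coefficient of `e 2`, and the ladder factor at weight `[a + 1]` kills
the path downwards, so `e 1` is an eigenvector. After cancellation its eigenvalue is `i (q⁻² + wt q
a 0 ^ 2) / wt q a 0`, against the counit `i (q⁻⁴ + wt q a 0 ^ 2) / wt q a 0`; they differ because
`q² ≠ 1`. -/
theorem rep_sub_eps_e_one (q : Param) (a : ℝ) : ∃ (b : Podles q a) (z : ℂ), z ≠ 0 ∧
    rep q a b (D2.e q a 1) - eps q a b • D2.e q a 1 = z • D2.e q a 1 := by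
  refine ⟨upDown q a (-(Complex.I * (wt q a 4)⁻¹)),
    Complex.I * (qc q ^ 2 - 1) / (qc q ^ 4 * wt q a 0), ?_, ?_⟩
  · exact div_ne_zero (mul_ne_zero Complex.I_ne_zero (qc_sq_ne_one q))
      (mul_ne_zero (pow_ne_zero _ (Oq.qc_ne q)) (wt_ne q a 0))
  · have h0 : stepDown q a (wt q a 0) (-(-(Complex.I * (wt q a 4)⁻¹))) 1 (2 * 1 + 2) = 0 := by
      simp [stepDown]
    have h1 : stepUp q a (-(wt q a 1)⁻¹) 1 0 (2 * 1 - 1) = 0 := by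
      simp [stepUp]
    rw [rep_upDown _ _ _ one_ne_zero, h0, h1, sub_self, D2.e_zero, eps_upDown]
    simp only [zero_mul, mul_zero, zero_smul, smul_zero, zero_add, add_zero, ← sub_smul]
    congr 1
    have e1 : wt q a 1 = wt q a 0 * qc q := by simpa using wt_add q a 0 1
    have e2 : wt q a (2 * 1) = wt q a 0 * qc q ^ 2 := wt_add q a 0 2
    have e3 : wt q a (2 * 1 + 1) = wt q a 0 * qc q ^ 3 := wt_add q a 0 3
    have e4 : wt q a 4 = wt q a 0 * qc q ^ 4 := by simpa using wt_add q a 0 4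
    have c2 := sq_ne q a (2 * 1)
    have c3 := sq_ne q a (2 * 1 + 1)
    have hw := wt_ne q a 0
    have hq := Oq.qc_ne q
    have d2 : (wt q a 0 * qc q ^ 2) ^ 2 + 1 ≠ 0 := e2 ▸ c2
    have d3 : (wt q a 0 * qc q ^ 3) ^ 2 + 1 ≠ 0 := e3 ▸ c3
    simp only [stepUp, stepDown, curC, e1, e2, e3, e4]
    clear * - d2 d3 hw hq
    generalize wt q a 0 = E at *
    generalize qc q = p at *
    have d2' : E ^ 2 * p ^ 4 + 1 ≠ 0 := fun h => d2 (by linear_combination h)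
    have d3' : E ^ 2 * p ^ 6 + 1 ≠ 0 := fun h => d3 (by linear_combination h)
    field_simp
    ring

/-- The mirror image: `downUp` is needed because its right factor kills the path from `[a - 2]` up
through `[a - 1]`, and the parameter kills the coefficient of `e (-2)`. -/
theorem rep_sub_eps_e_neg_one (q : Param) (a : ℝ) : ∃ (b : Podles q a) (z : ℂ), z ≠ 0 ∧
    rep q a b (D2.e q a (-1)) - eps q a b • D2.e q a (-1) = z • D2.e q a (-1) := by
  refine ⟨downUp q a (Complex.I * wt q a (-4)),
    -(Complex.I * (qc q ^ 2 - 1) * wt q a 0) / qc q ^ 4, ?_, ?_⟩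
  · have hI := Complex.I_ne_zero
    have hw := wt_ne q a 0
    have hq := Oq.qc_ne q
    have hp := qc_sq_ne_one q
    exact div_ne_zero (neg_ne_zero.2 (mul_ne_zero (mul_ne_zero hI hp) hw)) (pow_ne_zero 4 hq)
  · have h0 : stepUp q a (-(wt q a 0)⁻¹) (-(Complex.I * wt q a (-4))) 1 (2 * -1 - 2) = 0 := by
      simp [stepUp]
    have h1 : stepDown q a (wt q a (-1)) 1 0 (2 * -1 + 1) = 0 := by
      simp [stepDown]
    rw [rep_downUp _ _ _ (by decide), h0, h1, neg_add_cancel, D2.e_zero, eps_downUp]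
    simp only [zero_mul, mul_zero, zero_smul, smul_zero, zero_add, add_zero, ← sub_smul]
    congr 1
    -- Weights are expressed through the lowest one, so that only nonnegative powers of `q` appear.
    have e0 : wt q a 0 = wt q a (-4) * qc q ^ 4 := by
      rw [show (0 : ℤ) = -4 + 4 by norm_num, wt_add]
      rfl
    have e1 : wt q a (-1) = wt q a (-4) * qc q ^ 3 := by
      rw [show (-1 : ℤ) = -4 + 3 by norm_num, wt_add]
      rfl
    have e2 : wt q a (2 * -1) = wt q a (-4) * qc q ^ 2 := by
      rw [show (2 * -1 : ℤ) = -4 + 2 by norm_num, wt_add]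
      rfl
    have e3 : wt q a (2 * -1 - 1) = wt q a (-4) * qc q := by
      rw [show (2 * -1 - 1 : ℤ) = -4 + 1 by norm_num, wt_add, zpow_one]
    have c2 := sq_ne q a (2 * -1)
    have c3 := sq_ne q a (2 * -1 - 1)
    have hw := wt_ne q a (-4)
    have hq := Oq.qc_ne q
    have d2 : (wt q a (-4) * qc q ^ 2) ^ 2 + 1 ≠ 0 := e2 ▸ c2
    have d3 : (wt q a (-4) * qc q) ^ 2 + 1 ≠ 0 := e3 ▸ c3
    simp only [stepUp, stepDown, curC, e0, e1, e2, e3]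
    clear * - d2 d3 hw hq
    generalize wt q a (-4) = E at *
    generalize qc q = p at *
    have d2' : E ^ 2 * p ^ 4 + 1 ≠ 0 := fun h => d2 (by linear_combination h)
    have d3' : E ^ 2 * p ^ 2 + 1 ≠ 0 := fun h => d3 (by linear_combination h)
    field_simp
    ring

/-- No density argument is needed: every vector of `H` lies in the span itself, hence in its double
orthogonal complement, where the projection onto the complement vanishes. -/
theorem isPurelyNonGaussian_of_span_eq_top {B H : Type*} [Ring B] [Algebra ℂ B]
    [NormedAddCommGroup H] [InnerProductSpace ℂ H] {π : B →ₐ[ℂ] Module.End ℂ H} {ε : B →ₐ[ℂ] ℂ}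
    {C : B →ₗ[ℂ] H} (h : Submodule.span ℂ {v | ∃ b c : B, v = π b (C c) - ε b • C c} = ⊤) :
    IsPurelyNonGaussian π ε C := by
  intro v
  rw [gaussProj, Submodule.starProjection_apply_eq_zero_iff]
  refine Submodule.le_orthogonal_orthogonal _ ?_
  have hv : v ∈ Submodule.span ℂ {v | ∃ b c : B, v = π b (C c) - ε b • C c} := by simp [h]
  induction hv using Submodule.span_induction with
  | mem x hx =>
    obtain ⟨b, c, rfl⟩ := hx
    exact Submodule.subset_span ⟨b, c, rfl⟩
  | zero => exact zero_mem _
  | add x y _ _ hx hy => rw [UniformSpace.Completion.coe_add]; exact add_mem hx hy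
  | smul c x _ hx => rw [UniformSpace.Completion.coe_smul]; exact Submodule.smul_mem _ _ hx

theorem isPurelyNonGaussian_cocycle (q : Param) (a : ℝ) :
    IsPurelyNonGaussian (rep q a) (eps q a) (cocycle q a) := by
  refine isPurelyNonGaussian_of_span_eq_top ?_
  set W := Submodule.span ℂ
    {v | ∃ b c : Podles q a, v = rep q a b (cocycle q a c) - eps q a b • cocycle q a c} with hWdef
  have hmem : ∀ (b : Podles q a) (v : D2 q a), rep q a b v - eps q a b • v ∈ W := by
    intro b v
    obtain ⟨c, rfl⟩ := cocycle_surjective q a v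
    exact Submodule.subset_span ⟨b, c, rfl⟩
  refine D2.eq_top_of_mem W (fun b v hv => ?_) ?_ ?_
  -- `π(b) v = (π(b) - ε(b)) v + ε(b) v`.
  · simpa using add_mem (hmem b v) (Submodule.smul_mem _ (eps q a b) hv)
  · obtain ⟨b, z, hz, h⟩ := rep_sub_eps_e_one q a
    exact (Submodule.smul_mem_iff _ hz).1 (h ▸ hmem b _)
  · obtain ⟨b, z, hz, h⟩ := rep_sub_eps_e_neg_one q a
    exact (Submodule.smul_mem_iff _ hz).1 (h ▸ hmem b _)

end QPodles

end

theorem mainTheorem3 (q : Set.Ioo (0 : ℝ) 1) (a : ℝ) :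
    (∀ (b : QPodles.Podles q a), ∀ v ∈ QPodles.D2.plus q a,
      QPodles.rep q a b v ∈ QPodles.D2.plus q a) ∧
    (∀ (b : QPodles.Podles q a), ∀ v ∈ QPodles.D2.minus q a,
      QPodles.rep q a b v ∈ QPodles.D2.minus q a) ∧
    QPodles.IsStarRep (QPodles.rep q a) ∧
    QPodles.IsOneCocycle (QPodles.rep q a) (QPodles.eps q a) (QPodles.cocycle q a) ∧
    Function.Surjective (QPodles.cocycle q a) ∧
    QPodles.IsPurelyNonGaussian (QPodles.rep q a) (QPodles.eps q a) (QPodles.cocycle q a) :=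
  ⟨fun b _ hv => QPodles.D2.rep_mem_plus b hv, fun b _ hv => QPodles.D2.rep_mem_minus b hv,
    QPodles.isStarRep_rep q a, QPodles.isOneCocycle_cocycle q a, QPodles.cocycle_surjective q a,
    QPodles.isPurelyNonGaussian_cocycle q a⟩
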